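/- Fix $k\ge 2$; all local Hilbert spaces are finite-dimensional and logarithms are to base 2. An LOCC protocol is a finite-round protocol of local measurements (with finitely many outcomes) and classical communication; it transforms $\psi$ into a unit vector $\varphi$ with probability $p$ if, summing over the branches declared successful, the subnormalised output state is $p|\varphi\rangle\langle\varphi|$. For unit vectors $\psi,\varphi$ and $R,r\ge 0$, the pair $(R,r)$ is achievable if there is a sequence of LOCC protocols transforming $\psi^{\otimes n}$ into $\varphi^{\otimes (Rn+o(n))}$ with probability at least $2^{-rn+o(n)}$. A spectral point with exponent $\alpha\in[0,1]$ is a functional $F\ge 0$ on (unnormalised) $k$-partite vectors, invariant under local isometries, with $F(\sqrt{t}\,\psi)=t^\alpha F(\psi)$ for $t>0$, $F(\langle r\rangle)=r$ for the rank-$r$ unit tensor $\langle r\rangle=\sum_{a=1}^r|a\rangle\otimes\dots\otimes|a\rangle$, $F(\psi\otimes\varphi)=F(\psi)F(\varphi)$, $F(\psi\oplus\varphi)=F(\psi)+F(\varphi)$, and $F(\psi)^{1/\alpha}\ge F(\Pi\psi)^{1/\alpha}+F((I-\Pi)\psi)^{1/\alpha}$ for every orthogonal projection $\Pi$ acting on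 a single tensor factor (for $\alpha=0$: $F(\psi)\ge\max\{F(\Pi\psi),F((I-\Pi)\psi)\}$). For $\alpha\in[0,1)$, $E=\frac{1}{1-\alpha}\log F$ (on nonzero vectors) is then called a logarithmic spectral point of order $\alpha$; a logarithmic spectral point of order $1$ is a functional on unit vectors that is a pointwise limit (of a net) of logarithmic spectral points of orders $\alpha\in(0,1)$ with $\alpha\to1$. Let $d(q\|p)=q\log\frac{q}{p}+(1-q)\log\frac{1-q}{1-p}$, with $0\log0=0$ and $0\log\frac00=0$. Let $\psi,\varphi$ be normalised $k$-partite state vectors, $m,n\in\mathbb{N}$, $n\ge1$, $p\in[0,1]$, and suppose that an LOCC protocol transforms $\psi^{\otimes n}$ into $\varphi^{\otimes m}$ with probability $p$. Then: (1) For every $q\in[0,1]$ with $d(\max\{p,q\}\|p)<\infty$ (that is, $p>0$ or $q=0$), the pair $$(R,r)=\left(q\frac{m}{n},\ \frac1n\, d(\max\{p,q\}\|p)\right)$$ is achievable. (2) For every $\alpha\in(0,1)$ and every logarithmic spectral point $E$ of order $\alpha$, $$E(\psi)\ge\frac1n\frac{\alpha}{1-\alpha}\log\left[p\,2^{m\frac{1-\alpha}{\alpha}E(\varphi)}+(1-p)\right].$$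 (3) If $p>0$, then every logarithmic spectral point $E$ of order $0$ satisfies $E(\psi)\ge\frac mn E(\varphi)$. (4) Every logarithmic spectral point $E$ of order $1$ satisfies $E(\psi)\ge p\frac mn E(\varphi)$. -/

import Mathlib

open scoped Matrix

namespace LOCCSpectrum

noncomputable section

/-- A `k`-partite quantum system with finite-dimensional local Hilbert spaces.  The Hilbert space of
party `i` is `ℂ^(idx i)`, with its standard orthonormal basis indexed by the finite set `idx i`. -/
structure Sys (k : ℕ) where
  idx : Fin k → Type
  [fin : ∀ i, Fintype (idx i)]
  [dec : ∀ i, DecidableEq (idx i)]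

attribute [instance] Sys.fin Sys.dec

variable {k : ℕ}

/-- The joint Hilbert space `⨂ᵢ ℂ^(idx i)`, in coordinates with respect to the product basis. -/
abbrev Sys.H (S : Sys k) : Type := EuclideanSpace ℂ (∀ i, S.idx i)

/-- `k`-partite tensor product: party `i` holds `ℂ^(S.idx i) ⊗ ℂ^(T.idx i)`. -/
abbrev Sys.tensor (S T : Sys k) : Sys k where
  idx i := S.idx i × T.idx i

/-- `k`-partite direct sum: party `i` holds `ℂ^(S.idx i) ⊕ ℂ^(T.idx i)`. -/
abbrev Sys.sum (S T : Sys k) : Sys k where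
  idx i := S.idx i ⊕ T.idx i

/-- `n` copies of a system: party `i` holds `(ℂ^(S.idx i))^{⊗ n}`. -/
abbrev Sys.pow (S : Sys k) (n : ℕ) : Sys k where
  idx i := Fin n → S.idx i

/-- The system in which every party holds `ℂ^r`. -/
abbrev Sys.diag (k r : ℕ) : Sys k where
  idx _ := Fin r

/-- The vector `ψ ⊗ φ`. -/
def tensorVec {S T : Sys k} (ψ : S.H) (φ : T.H) : (S.tensor T).H :=
  WithLp.toLp 2 fun x => ψ (fun i => (x i).1) * φ (fun i => (x i).2)

/-- The vector `ψ ⊕ φ`, with `ψ` on the all-left and `φ` on the all-right summand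
of `⨂ᵢ (ℂ^(S.idx i) ⊕ ℂ^(T.idx i))`. -/
def sumVec {S T : Sys k} (ψ : S.H) (φ : T.H) : (S.sum T).H :=
  WithLp.toLp 2 fun x : ∀ i, S.idx i ⊕ T.idx i =>
    (∑ a : ∀ i, S.idx i, if x = (fun i => Sum.inl (a i)) then ψ a else 0) +
      ∑ b : ∀ i, T.idx i, if x = (fun i => Sum.inr (b i)) then φ b else 0

/-- The vector `ψ^{⊗ n}`. -/
def powVec {S : Sys k} (ψ : S.H) (n : ℕ) : (S.pow n).H :=
  WithLp.toLp 2 fun x => ∏ t : Fin n, ψ (fun i => x i t)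

/-- The unit tensor `∑_{a < r} |a⟩ ⊗ ⋯ ⊗ |a⟩` of rank `r`. -/
def unitVec (k r : ℕ) : (Sys.diag k r).H :=
  WithLp.toLp 2 fun x : Fin k → Fin r => if ∃ a : Fin r, ∀ i, x i = a then 1 else 0

/-- The vector `(A₁ ⊗ ⋯ ⊗ A_k) ψ` for local operators `Aᵢ`. -/
def localApply {S T : Sys k} (A : ∀ i, Matrix (T.idx i) (S.idx i) ℂ) (ψ : S.H) : T.H :=
  WithLp.toLp 2 fun y => ∑ x : ∀ i, S.idx i, (∏ i, A i (y i) (x i)) * ψ x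

/-- The vector `(I ⊗ ⋯ ⊗ P ⊗ ⋯ ⊗ I) ψ` with `P` acting at party `j`. -/
def siteApply {S : Sys k} (j : Fin k) (P : Matrix (S.idx j) (S.idx j) ℂ) (ψ : S.H) : S.H :=
  localApply (T := S)
    (Function.update (fun i => (1 : Matrix (S.idx i) (S.idx i) ℂ)) j P) ψ

/-- A finite-round LOCC protocol from the system `S` to the target system `T`.  It either stops
(declaring success, which is possible only if the current system is `T`, or failure), or performs a
round: party `j` measures with Kraus operators `A ω j`, announces the outcome `ω`, the other parties
apply local isometries `A ω i` depending on `ω`, and the protocol continues as `next ω`. General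
local channels are obtained when later rounds ignore the outcome. -/
inductive Protocol (T : Sys k) : Sys k → Type 1
  | success : Protocol T T
  | failure (S : Sys k) : Protocol T S
  | round (S : Sys k) (j : Fin k) (N : ℕ) (S' : Fin N → Sys k)
      (A : ∀ (ω : Fin N) (i : Fin k), Matrix ((S' ω).idx i) (S.idx i) ℂ)
      (isometry : ∀ ω i, i ≠ j → (A ω i)ᴴ * A ω i = 1)
      (complete : ∑ ω, (A ω j)ᴴ * A ω j = 1)
      (next : ∀ ω, Protocol T (S' ω)) : Protocol T S

/-- The operator `|ψ⟩⟨ψ|`. -/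
def ketbra {S : Sys k} (ψ : S.H) : Matrix (∀ i, S.idx i) (∀ i, S.idx i) ℂ :=
  Matrix.vecMulVec ψ.ofLp (star ψ.ofLp)

/-- The subnormalised output state on success, for the pure input `ψ`: the sum of the
unnormalised post-measurement states `|v⟩⟨v|` over all branches that end in success. The success
probability is its trace. -/
def Protocol.output {T : Sys k} :
    {S : Sys k} → Protocol T S → S.H → Matrix (∀ i, T.idx i) (∀ i, T.idx i) ℂ
  | _, .success, ψ => ketbra ψ
  | _, .failure _, _ => 0
  | _, .round _ _ _ _ A _ _ next, ψ => ∑ ω, (next ω).output (localApply (A ω) ψ)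

/-- Some LOCC protocol transforms `ψ` into the (normalised) state `φ` with probability `p`. -/
def Transforms {S T : Sys k} (ψ : S.H) (φ : T.H) (p : ℝ) : Prop :=
  ∃ P : Protocol T S, P.output ψ = (p : ℂ) • ketbra φ

/-- The rate `R` is achievable with strong converse exponent `r` for transforming `ψ` into `φ`. -/
def Achievable {S T : Sys k} (ψ : S.H) (φ : T.H) (R r : ℝ) : Prop :=
  0 ≤ R ∧ 0 ≤ r ∧
  ∃ (M : ℕ → ℕ) (e : ℕ → ℝ),
    (fun n : ℕ => (M n : ℝ) - R * n) =o[Filter.atTop] (fun n : ℕ => (n : ℝ)) ∧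
    e =o[Filter.atTop] (fun n : ℕ => (n : ℝ)) ∧
    ∀ n : ℕ, ∃ p : ℝ, (2 : ℝ) ^ (-r * n + e n) ≤ p ∧
      Transforms (powVec ψ n) (powVec φ (M n)) p

/-- Binary relative entropy `d(q‖p)` in bits.  The formula is the relative entropy (with
`0 log 0 = 0`) whenever the latter is finite, i.e. when `p = 0` implies `q = 0` and
`p = 1` implies `q = 1`. -/
def binRelEntropy (q p : ℝ) : ℝ :=
  q * Real.logb 2 (q / p) + (1 - q) * Real.logb 2 ((1 - q) / (1 - p))

/-- Real-valued functionals on `k`-partite unnormalised vectors. -/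
abbrev Functional (k : ℕ) := ∀ S : Sys k, S.H → ℝ

/-- Elements, with exponent `α`, of the asymptotic spectrum of LOCC transformations.  At `α = 0` the
last condition is read, as usual, as its limit `F ψ ≥ max (F (Π ψ)) (F ((I - Π) ψ))`. -/
structure IsSpectralPoint (α : ℝ) (F : Functional k) : Prop where
  order_mem : α ∈ Set.Icc (0 : ℝ) 1
  nonneg : ∀ (S : Sys k) (ψ : S.H), 0 ≤ F S ψ
  isometry_invariant : ∀ (S T : Sys k) (V : ∀ i, Matrix (T.idx i) (S.idx i) ℂ) (ψ : S.H),
    (∀ i, (V i)ᴴ * V i = 1) → F T (localApply V ψ) = F S ψ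
  scaling : ∀ (S : Sys k) (ψ : S.H) (p : ℝ), 0 < p →
    F S (((Real.sqrt p : ℝ) : ℂ) • ψ) = p ^ α * F S ψ
  unit : ∀ r : ℕ, F (Sys.diag k r) (unitVec k r) = r
  multiplicative : ∀ (S T : Sys k) (ψ : S.H) (φ : T.H),
    F (S.tensor T) (tensorVec ψ φ) = F S ψ * F T φ
  additive : ∀ (S T : Sys k) (ψ : S.H) (φ : T.H),
    F (S.sum T) (sumVec ψ φ) = F S ψ + F T φ
  projection : ∀ (S : Sys k) (ψ : S.H) (j : Fin k) (P : Matrix (S.idx j) (S.idx j) ℂ),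
    P.IsHermitian → P * P = P →
      if α = 0 then max (F S (siteApply j P ψ)) (F S (siteApply j (1 - P) ψ)) ≤ F S ψ
      else F S (siteApply j P ψ) ^ (1 / α) + F S (siteApply j (1 - P) ψ) ^ (1 / α)
        ≤ F S ψ ^ (1 / α)

/-- `E` is (on nonzero vectors) a logarithmic spectral point of order `α ∈ [0, 1)`. -/
def IsLogSpectralPoint (α : ℝ) (E : Functional k) : Prop :=
  α < 1 ∧ ∃ F : Functional k, IsSpectralPoint α F ∧
    ∀ (S : Sys k) (ψ : S.H), ψ ≠ 0 → E S ψ = Real.logb 2 (F S ψ) / (1 - α)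

/-- `E` is (on normalised vectors) a logarithmic spectral point of order one: since the
normalisation `1 / (1 - α)` excludes `α = 1`, this means a pointwise limit, along some filter (net),
of logarithmic spectral points of orders `α ∈ (0, 1)` with `α → 1`. -/
def IsLogSpectralPointOne (E : Functional k) : Prop :=
  ∃ l : Filter (ℝ × Functional k), l.NeBot ∧
    (∀ᶠ x in l, x.1 ∈ Set.Ioo (0 : ℝ) 1 ∧ IsLogSpectralPoint x.1 x.2) ∧
    Filter.Tendsto Prod.fst l (nhds 1) ∧
    ∀ (S : Sys k) (ψ : S.H), ‖ψ‖ = 1 →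
      Filter.Tendsto (fun x : ℝ × Functional k => x.2 S ψ) l (nhds (E S ψ))

end

end LOCCSpectrum

open LOCCSpectrum

open scoped Matrix

namespace LOCCSpectrum

noncomputable section

variable {k : ℕ}

/-! The theorem has a constructive half (the achievable pairs) and a converse half (the three bounds
on spectral points). Both rest on one observation: if the summed output is a multiple of `ketbra φ`,
then every successful branch ends in a multiple of `φ`, because the output is a sum of positive
semidefinite terms (`Protocol.aligned_of_output`).

Achievability: this alignment allows protocols to be composed, with different continuations after
success and failure (`Protocol.exists_bind`). Running the given protocol on `N = ⌊L/n⌋` blocks of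
`L` copies then gives exactly `s` successes with binomial probability. For `s ≈ max p q * N` this is
`2 ^ (-N * d)` up to a polynomial factor, where `d` is the relative entropy of `max p q` and `p`
(`two_rpow_binRelEntropy_le`); surplus copies are discarded.

Converse: a Kraus measurement dilates to a local isometry and a projective measurement
(`exists_dilation`), so the projection axiom makes `F ^ (1/α)` nonincreasing on average under LOCC.
A successful branch contributes its probability times `F φ ^ (1/α)`, a failed one at least its
probability, since `‖v‖² ≤ F v ^ (1/α)`. Taking logarithms gives orders in `(0, 1)`. At order 0 a
single successful branch suffices; order 1 follows from concavity of the logarithm and a limit. -/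

lemma localApply_apply {S T : Sys k} (A : ∀ i, Matrix (T.idx i) (S.idx i) ℂ) (ψ : S.H)
    (y : ∀ i, T.idx i) :
    localApply A ψ y = ∑ x : ∀ i, S.idx i, (∏ i, A i (y i) (x i)) * ψ x := rfl

lemma tensorVec_apply {S T : Sys k} (ψ : S.H) (φ : T.H) (x : ∀ i, S.idx i × T.idx i) :
    tensorVec ψ φ x = ψ (fun i => (x i).1) * φ (fun i => (x i).2) := rfl

lemma powVec_apply {S : Sys k} (ψ : S.H) (n : ℕ) (x : ∀ i, Fin n → S.idx i) :
    powVec ψ n x = ∏ t : Fin n, ψ (fun i => x i t) := rfl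

/-! ### Local operators, norms and tensor products. -/

lemma localApply_localApply {S T U : Sys k} (B : ∀ i, Matrix (U.idx i) (T.idx i) ℂ)
    (A : ∀ i, Matrix (T.idx i) (S.idx i) ℂ) (ψ : S.H) :
    localApply B (localApply A ψ) = localApply (fun i => B i * A i) ψ := by
  ext z
  simp only [localApply_apply, Matrix.mul_apply, Finset.prod_univ_sum, Fintype.piFinset_univ,
    Finset.mul_sum, Finset.sum_mul, Finset.prod_mul_distrib]
  rw [Finset.sum_comm]
  simp only [mul_assoc]

lemma localApply_one {S : Sys k} (ψ : S.H) :
    localApply (fun i => (1 : Matrix (S.idx i) (S.idx i) ℂ)) ψ = ψ := by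
  ext z
  simp only [localApply_apply, Matrix.one_apply, Fintype.prod_boole, ← funext_iff]
  simp

lemma localApply_smul {S T : Sys k} (A : ∀ i, Matrix (T.idx i) (S.idx i) ℂ) (z : ℂ) (ψ : S.H) :
    localApply A (z • ψ) = z • localApply A ψ := by
  ext y
  simp only [localApply_apply, PiLp.smul_apply, smul_eq_mul, Finset.mul_sum]
  exact Finset.sum_congr rfl fun x _ => by ring

lemma inner_localApply_left {S T : Sys k} (A : ∀ i, Matrix (T.idx i) (S.idx i) ℂ) (ψ : S.H)
    (χ : T.H) : inner ℂ (localApply A ψ) χ = inner ℂ ψ (localApply (fun i => (A i)ᴴ) χ) := by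
  simp only [PiLp.inner_apply, RCLike.inner_apply, localApply_apply, map_sum, map_mul, map_prod,
    Finset.mul_sum, Finset.sum_mul, Matrix.conjTranspose_apply]
  rw [Finset.sum_comm]
  refine Finset.sum_congr rfl fun x _ => Finset.sum_congr rfl fun y _ => ?_
  simp only [RCLike.star_def]
  ring

lemma sum_localApply_update {S T : Sys k} {ι : Type*} (s : Finset ι) (j : Fin k)
    (A : ∀ i, Matrix (T.idx i) (S.idx i) ℂ) (M : ι → Matrix (T.idx j) (S.idx j) ℂ) (ψ : S.H) :
    ∑ ω ∈ s, localApply (Function.update A j (M ω)) ψ =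
      localApply (Function.update A j (∑ ω ∈ s, M ω)) ψ := by
  have key : ∀ (B : Matrix (T.idx j) (S.idx j) ℂ) (y : ∀ i, T.idx i) (x : ∀ i, S.idx i),
      ∏ i, Function.update A j B i (y i) (x i) =
        B (y j) (x j) * ∏ i ∈ Finset.univ.erase j, A i (y i) (x i) := by
    intro B y x
    rw [← Finset.mul_prod_erase _ _ (Finset.mem_univ j)]
    simp only [Function.update_self]
    congr 1
    refine Finset.prod_congr rfl fun i hi => ?_
    rw [Function.update_of_ne (Finset.ne_of_mem_erase hi)]
  ext y
  simp only [WithLp.ofLp_sum, Finset.sum_apply, localApply_apply, key, Matrix.sum_apply,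
    Finset.sum_mul]
  rw [Finset.sum_comm]

lemma norm_sq_eq_inner_re {S : Sys k} (ψ : S.H) : ‖ψ‖ ^ 2 = (inner ℂ ψ ψ : ℂ).re :=
  norm_sq_eq_re_inner (𝕜 := ℂ) ψ

/-- A local measurement preserves the total probability. -/
lemma sum_norm_sq_localApply {S : Sys k} {N : ℕ} {S' : Fin N → Sys k} (j : Fin k)
    (A : ∀ (ω : Fin N) (i : Fin k), Matrix ((S' ω).idx i) (S.idx i) ℂ)
    (isometry : ∀ ω i, i ≠ j → (A ω i)ᴴ * A ω i = 1)
    (complete : ∑ ω, (A ω j)ᴴ * A ω j = 1) (ψ : S.H) :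
    ∑ ω, ‖localApply (A ω) ψ‖ ^ 2 = ‖ψ‖ ^ 2 := by
  have h : ∀ ω, (fun i => (A ω i)ᴴ * A ω i) =
      Function.update (fun i => (1 : Matrix (S.idx i) (S.idx i) ℂ)) j ((A ω j)ᴴ * A ω j) := by
    intro ω
    funext i
    by_cases hi : i = j
    · subst hi; simp
    · rw [Function.update_of_ne hi, isometry ω i hi]
  simp only [norm_sq_eq_inner_re, inner_localApply_left, localApply_localApply, h]
  rw [← Complex.re_sum, ← inner_sum, sum_localApply_update, complete,
    Function.update_eq_self_iff.mpr rfl, localApply_one]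

lemma norm_localApply_of_isometry {S T : Sys k} (V : ∀ i, Matrix (T.idx i) (S.idx i) ℂ)
    (hV : ∀ i, (V i)ᴴ * V i = 1) (ψ : S.H) : ‖localApply V ψ‖ = ‖ψ‖ := by
  have : ‖localApply V ψ‖ ^ 2 = ‖ψ‖ ^ 2 := by
    simp only [norm_sq_eq_inner_re, inner_localApply_left, localApply_localApply, hV,
      localApply_one]
  exact (pow_left_inj₀ (norm_nonneg _) (norm_nonneg _) two_ne_zero).mp this

/-- Pairs of local index tuples. -/
def piProdEquiv (S T : Sys k) :
    (∀ i, S.idx i × T.idx i) ≃ (∀ i, S.idx i) × (∀ i, T.idx i) where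
  toFun x := (fun i => (x i).1, fun i => (x i).2)
  invFun y i := (y.1 i, y.2 i)
  left_inv _ := rfl
  right_inv _ := rfl

lemma localApply_kronecker {S S' T T' : Sys k} (A : ∀ i, Matrix (S'.idx i) (S.idx i) ℂ)
    (B : ∀ i, Matrix (T'.idx i) (T.idx i) ℂ) (ψ : S.H) (φ : T.H) :
    localApply (S := S.tensor T) (T := S'.tensor T')
      (fun i => Matrix.kroneckerMap (· * ·) (A i) (B i)) (tensorVec ψ φ) =
      tensorVec (localApply A ψ) (localApply B φ) := by
  ext y
  simp only [localApply_apply, tensorVec_apply, Matrix.kroneckerMap_apply, Finset.prod_mul_distrib]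
  rw [Finset.sum_mul_sum, ← Finset.sum_product', Finset.univ_product_univ,
    ← (piProdEquiv S T).sum_comp]
  refine Finset.sum_congr rfl fun x _ => ?_
  simp only [piProdEquiv, Equiv.coe_fn_mk]
  ring

lemma norm_tensorVec {S T : Sys k} (ψ : S.H) (φ : T.H) : ‖tensorVec ψ φ‖ = ‖ψ‖ * ‖φ‖ := by
  have : ‖tensorVec ψ φ‖ ^ 2 = (‖ψ‖ * ‖φ‖) ^ 2 := by
    rw [mul_pow, EuclideanSpace.norm_sq_eq, EuclideanSpace.norm_sq_eq, EuclideanSpace.norm_sq_eq,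
      Finset.sum_mul_sum, ← Finset.sum_product', Finset.univ_product_univ,
      ← (piProdEquiv S T).sum_comp]
    refine Finset.sum_congr rfl fun x _ => ?_
    rw [← mul_pow, ← norm_mul]
    rfl
  exact (pow_left_inj₀ (norm_nonneg _) (by positivity) two_ne_zero).mp this

lemma smul_tensorVec {S T : Sys k} (z : ℂ) (ψ : S.H) (φ : T.H) :
    tensorVec (z • ψ) φ = z • tensorVec ψ φ := by
  ext y
  simp only [tensorVec_apply, PiLp.smul_apply, smul_eq_mul, mul_assoc]

lemma kronecker_isometry {l m n o : Type} [Fintype l] [Fintype m] [Fintype n] [Fintype o]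
    [DecidableEq m] [DecidableEq o] {A : Matrix l m ℂ} {B : Matrix n o ℂ}
    (hA : Aᴴ * A = 1) (hB : Bᴴ * B = 1) :
    (Matrix.kroneckerMap (· * ·) A B)ᴴ * Matrix.kroneckerMap (· * ·) A B = 1 := by
  rw [Matrix.conjTranspose_kronecker, ← Matrix.mul_kronecker_mul, hA, hB, Matrix.one_kronecker_one]

/-! ### Reindexing of local bases. -/

/-- Two vectors agree up to renaming the local basis elements. -/
def Renaming {S T : Sys k} (ψ : S.H) (φ : T.H) : Prop :=
  ∃ e : ∀ i, S.idx i ≃ T.idx i, ∀ x : ∀ i, S.idx i, φ (fun i => e i (x i)) = ψ x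

lemma Renaming.symm {S T : Sys k} {ψ : S.H} {φ : T.H} (h : Renaming ψ φ) : Renaming φ ψ := by
  obtain ⟨e, he⟩ := h
  refine ⟨fun i => (e i).symm, fun x => ?_⟩
  rw [← he]
  simp

/-- The local permutation operators renaming the basis elements. -/
def renameMatrix {S T : Sys k} (e : ∀ i, S.idx i ≃ T.idx i) (i : Fin k) :
    Matrix (T.idx i) (S.idx i) ℂ :=
  Matrix.of fun y x => if y = e i x then 1 else 0

lemma renameMatrix_isometry {S T : Sys k} (e : ∀ i, S.idx i ≃ T.idx i) (i : Fin k) :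
    (renameMatrix e i)ᴴ * renameMatrix e i = 1 := by
  ext x x'
  simp [renameMatrix, Matrix.mul_apply, Matrix.one_apply, eq_comm]

lemma localApply_renameMatrix {S T : Sys k} (e : ∀ i, S.idx i ≃ T.idx i) {ψ : S.H} {φ : T.H}
    (he : ∀ x : ∀ i, S.idx i, φ (fun i => e i (x i)) = ψ x) :
    localApply (renameMatrix e) ψ = φ := by
  ext y
  have hy : ∀ x : ∀ i, S.idx i, (∀ i, y i = e i (x i)) ↔ x = fun i => (e i).symm (y i) := by
    intro x
    rw [funext_iff]
    exact forall_congr' fun i => by rw [Equiv.eq_symm_apply, eq_comm]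
  simp only [localApply_apply, renameMatrix, Matrix.of_apply, Fintype.prod_boole, hy]
  simp [← he]

/-- Since permutations of local bases are local unitaries, the bookkeeping of tensor powers is free
for protocols and invisible to spectral points. -/
lemma Renaming.exists_isometry {S T : Sys k} {ψ : S.H} {φ : T.H} (h : Renaming ψ φ) :
    ∃ V : ∀ i, Matrix (T.idx i) (S.idx i) ℂ, (∀ i, (V i)ᴴ * V i = 1) ∧ localApply V ψ = φ := by
  obtain ⟨e, he⟩ := h
  exact ⟨renameMatrix e, renameMatrix_isometry e, localApply_renameMatrix e he⟩

lemma Renaming.norm_eq {S T : Sys k} {ψ : S.H} {φ : T.H} (h : Renaming ψ φ) : ‖φ‖ = ‖ψ‖ := by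
  obtain ⟨V, hV, rfl⟩ := h.exists_isometry
  exact norm_localApply_of_isometry V hV ψ

lemma rename_tensor_swap {S T : Sys k} (ψ : S.H) (φ : T.H) :
    Renaming (tensorVec ψ φ) (tensorVec φ ψ) :=
  ⟨fun _ => Equiv.prodComm _ _, fun x => by simp [tensorVec_apply, mul_comm]⟩

lemma rename_powVec_add {S : Sys k} (ψ : S.H) (a b : ℕ) :
    Renaming (tensorVec (powVec ψ a) (powVec ψ b)) (powVec ψ (a + b)) :=
  ⟨fun _ => Fin.appendEquiv a b, fun x => by
    simp [tensorVec_apply, powVec_apply, Fin.prod_univ_add]⟩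

lemma rename_powVec_one {S : Sys k} (ψ : S.H) : Renaming (powVec ψ 1) ψ :=
  ⟨fun _ => Equiv.funUnique _ _, fun x => by simp [powVec_apply]⟩

lemma rename_tensor_powVec_zero {S T : Sys k} (ψ : S.H) (φ : T.H) :
    Renaming (tensorVec ψ (powVec φ 0)) ψ :=
  ⟨fun _ => Equiv.prodUnique _ _, fun x => by
    simp [tensorVec_apply, powVec_apply, Equiv.prodUnique]⟩

lemma rename_powVec_zero {S : Sys k} (ψ : S.H) : Renaming (powVec ψ 0) (unitVec k 1) :=
  ⟨fun _ => Equiv.ofUnique _ _, fun x => by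
    have : ∃ a : Fin 1, ∀ i : Fin k, (Equiv.ofUnique (Fin 0 → S.idx i) (Fin 1)) (x i) = a :=
      ⟨0, fun i => Subsingleton.elim _ _⟩
    simp [powVec_apply, unitVec]⟩

lemma norm_powVec {S : Sys k} (ψ : S.H) (n : ℕ) : ‖powVec ψ n‖ = ‖ψ‖ ^ n := by
  induction n with
  | zero =>
    rw [pow_zero, EuclideanSpace.norm_eq]
    simp [powVec_apply]
  | succ n ih =>
    rw [(rename_powVec_add ψ n 1).norm_eq, norm_tensorVec, ih, pow_succ,
      (rename_powVec_one ψ).symm.norm_eq]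

/-! ### Output states and alignment of successful branches. -/

lemma ketbra_smul {S : Sys k} (z : ℂ) (ψ : S.H) :
    ketbra (z • ψ) = ((‖z‖ ^ 2 : ℝ) : ℂ) • ketbra ψ := by
  ext x y
  simp only [ketbra, Matrix.vecMulVec_apply, WithLp.ofLp_smul, Pi.smul_apply, Pi.star_apply,
    smul_eq_mul, star_mul', Matrix.smul_apply]
  have : ((‖z‖ ^ 2 : ℝ) : ℂ) = z * star z := by
    rw [RCLike.star_def, Complex.mul_conj, Complex.normSq_eq_norm_sq]
  rw [this]
  ring

lemma trace_ketbra {S : Sys k} (ψ : S.H) : (ketbra ψ).trace = ((‖ψ‖ ^ 2 : ℝ) : ℂ) := by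
  rw [ketbra, Matrix.trace_vecMulVec, EuclideanSpace.norm_sq_eq]
  simp only [dotProduct, Pi.star_apply, RCLike.star_def, Complex.mul_conj,
    Complex.normSq_eq_norm_sq]
  push_cast
  rfl

namespace Protocol

lemma output_smul {S T : Sys k} (P : Protocol T S) (z : ℂ) (ψ : S.H) :
    P.output (z • ψ) = ((‖z‖ ^ 2 : ℝ) : ℂ) • P.output ψ := by
  induction P with
  | success => exact ketbra_smul z ψ
  | failure S => simp [output]
  | round S j N S' A isometry complete next ih =>
    simp only [output, localApply_smul, ih, Finset.smul_sum]

/-- The success probability of the protocol on the input `ψ`. -/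
def prob {S T : Sys k} (P : Protocol T S) (ψ : S.H) : ℝ := (P.output ψ).trace.re

lemma prob_success {T : Sys k} (ψ : T.H) : (success : Protocol T T).prob ψ = ‖ψ‖ ^ 2 := by
  simp only [prob, output, trace_ketbra, Complex.ofReal_re]

lemma prob_failure {S T : Sys k} (ψ : S.H) : (failure S : Protocol T S).prob ψ = 0 := by
  simp [prob, output]

lemma prob_round {S T : Sys k} (j : Fin k) (N : ℕ) (S' : Fin N → Sys k)
    (A : ∀ (ω : Fin N) (i : Fin k), Matrix ((S' ω).idx i) (S.idx i) ℂ)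
    (isometry : ∀ ω i, i ≠ j → (A ω i)ᴴ * A ω i = 1)
    (complete : ∑ ω, (A ω j)ᴴ * A ω j = 1) (next : ∀ ω, Protocol T (S' ω)) (ψ : S.H) :
    (round S j N S' A isometry complete next).prob ψ =
      ∑ ω, (next ω).prob (localApply (A ω) ψ) := by
  simp only [prob, output, Matrix.trace_sum, Complex.re_sum]

lemma prob_eq_of_output {S T : Sys k} {P : Protocol T S} {ψ : S.H} {φ : T.H} (hφ : ‖φ‖ = 1)
    {c : ℝ} (h : P.output ψ = (c : ℂ) • ketbra φ) : P.prob ψ = c := by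
  simp [prob, h, trace_ketbra, hφ]

/-- Every successful branch on the input `ψ` ends in a multiple of `φ`. -/
def Aligned {T : Sys k} (φ : T.H) : {S : Sys k} → Protocol T S → S.H → Prop
  | _, .success, ψ => ∃ z : ℂ, ψ = z • φ
  | _, .failure _, _ => True
  | _, .round _ _ _ _ A _ _ next, ψ => ∀ ω, Aligned φ (next ω) (localApply (A ω) ψ)

open scoped ComplexOrder in
lemma output_posSemidef {S T : Sys k} (P : Protocol T S) (ψ : S.H) :
    (P.output ψ).PosSemidef := by
  induction P with
  | success => exact Matrix.posSemidef_vecMulVec_self_star _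
  | failure S => exact Matrix.PosSemidef.zero
  | round S j N S' A isometry complete next ih =>
    exact Matrix.posSemidef_sum _ fun ω _ => ih ω _

-- Positivity lets the vanishing of the quadratic form at `w` pass from the sum to each branch. At a
-- success leaf, testing with the component of `ψ` orthogonal to `φ` shows that this component is
-- zero.
open scoped ComplexOrder in
lemma aligned_of_form_eq_zero {S T : Sys k} {φ : T.H} (hφ : ‖φ‖ = 1) (P : Protocol T S) (ψ : S.H)
    (h : ∀ w : T.H, inner ℂ w φ = 0 → star w.ofLp ⬝ᵥ (P.output ψ *ᵥ w.ofLp) = 0) :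
    P.Aligned φ ψ := by
  induction P with
  | success =>
    refine ⟨inner ℂ φ ψ, ?_⟩
    set w : T.H := ψ - (inner ℂ φ ψ : ℂ) • φ with hw
    have hφφ : inner ℂ φ φ = (1 : ℂ) := by
      rw [inner_self_eq_norm_sq_to_K, hφ]; simp
    have h1 : inner ℂ φ w = (0 : ℂ) := by
      rw [hw, inner_sub_right, inner_smul_right, hφφ, mul_one, sub_self]
    have h2 : inner ℂ w φ = (0 : ℂ) := by
      rw [← inner_conj_symm, h1, map_zero]
    have h3 := h w h2
    have h4 : star w.ofLp ⬝ᵥ (ketbra ψ *ᵥ w.ofLp) = inner ℂ w ψ * inner ℂ ψ w := by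
      rw [ketbra, Matrix.vecMulVec_mulVec, dotProduct_smul, EuclideanSpace.inner_eq_star_dotProduct,
        EuclideanSpace.inner_eq_star_dotProduct, dotProduct_comm ψ.ofLp (star w.ofLp),
        dotProduct_comm w.ofLp (star ψ.ofLp)]
      simp [mul_comm]
    have h5 : inner ℂ w ψ = (inner ℂ w w : ℂ) := by
      conv_rhs => rw [hw]
      rw [← hw, inner_sub_right, inner_smul_right, h2, mul_zero, sub_zero]
    have h6 : inner ℂ w ψ = (0 : ℂ) := by
      rw [output, h4] at h3
      rcases mul_eq_zero.mp h3 with h | h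
      · exact h
      · rw [← inner_conj_symm, h, map_zero]
    rw [h5, inner_self_eq_zero] at h6
    exact sub_eq_zero.mp h6
  | failure S => trivial
  | round S j N S' A isometry complete next ih =>
    intro ω
    refine ih ω _ fun w hw => ?_
    have h1 := h w hw
    simp only [output, Matrix.sum_mulVec, dotProduct_sum] at h1
    exact (Finset.sum_eq_zero_iff_of_nonneg fun ω _ =>
      (output_posSemidef (next ω) _).dotProduct_mulVec_nonneg w.ofLp).mp h1 ω (Finset.mem_univ ω)

lemma aligned_of_output {S T : Sys k} {φ : T.H} (hφ : ‖φ‖ = 1) {P : Protocol T S} {ψ : S.H}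
    {c : ℂ} (h : P.output ψ = c • ketbra φ) : P.Aligned φ ψ := by
  refine aligned_of_form_eq_zero hφ P ψ fun w hw => ?_
  have h1 : star φ.ofLp ⬝ᵥ w.ofLp = 0 := by
    rw [dotProduct_comm, ← EuclideanSpace.inner_eq_star_dotProduct, ← inner_conj_symm, hw, map_zero]
  rw [h, ketbra, Matrix.smul_mulVec, Matrix.vecMulVec_mulVec, h1]
  simp

end Protocol

/-! ### Changing one party's space; discarding a tensor factor. -/

/-- The first type if the flag is set, the second one otherwise. -/
abbrev Pick (b : Bool) (X Y : Type) : Type := match b with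
  | true => X
  | false => Y

/-- With a Boolean flag in place of the proposition `i = j`, case analysis makes the types reduce
definitionally and no casts appear. -/
instance {X Y : Type} [Fintype X] [Fintype Y] : ∀ b, Fintype (Pick b X Y)
  | true => inferInstanceAs (Fintype X)
  | false => inferInstanceAs (Fintype Y)

instance {X Y : Type} [DecidableEq X] [DecidableEq Y] : ∀ b, DecidableEq (Pick b X Y)
  | true => inferInstanceAs (DecidableEq X)
  | false => inferInstanceAs (DecidableEq Y)

/-- The system `S` with the space of party `j` replaced by that in `T`. -/
abbrev Sys.replaceAt (S T : Sys k) (j : Fin k) : Sys k where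
  idx i := Pick (decide (i = j)) (T.idx i) (S.idx i)

/-- The operator `K` if the flag is set, the identity otherwise. -/
def pickMatrix {X Y : Type} [DecidableEq Y] (K : Matrix X Y ℂ) :
    ∀ b : Bool, Matrix (Pick b X Y) Y ℂ
  | true => K
  | false => (1 : Matrix Y Y ℂ)

lemma pickMatrix_isometry {X Y : Type} [Fintype X] [Fintype Y] [DecidableEq Y]
    (K : Matrix X Y ℂ) (b : Bool) (h : b = true → Kᴴ * K = 1) :
    (pickMatrix K b)ᴴ * pickMatrix K b = 1 := by
  cases b with
  | true => exact h rfl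
  | false => exact (by simp : (1 : Matrix Y Y ℂ)ᴴ * 1 = 1)

lemma pickMatrix_complete {X Y ι : Type} [Fintype X] [Fintype Y] [DecidableEq Y] [Fintype ι]
    (K : ι → Matrix X Y ℂ) (b : Bool) (hb : b = true) (h : ∑ ω, (K ω)ᴴ * K ω = 1) :
    ∑ ω, (pickMatrix (K ω) b)ᴴ * pickMatrix (K ω) b = 1 := by
  subst hb
  exact h

lemma card_pick {X Y : Type} [Fintype X] [Fintype Y] (b : Bool) :
    Fintype.card (Pick b X Y) = if b then Fintype.card X else Fintype.card Y := by
  cases b <;> rfl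

lemma one_kronecker_complete {m n : Type} [Fintype m] [DecidableEq m] [Fintype n] [DecidableEq n]
    {N : ℕ} {l : Fin N → Type} [∀ ω, Fintype (l ω)]
    (K : ∀ ω, Matrix (l ω) m ℂ) (h : ∑ ω, (K ω)ᴴ * K ω = 1) :
    ∑ ω, (Matrix.kroneckerMap (· * ·) (K ω) (1 : Matrix n n ℂ))ᴴ *
      Matrix.kroneckerMap (· * ·) (K ω) (1 : Matrix n n ℂ) = 1 := by
  have : ∀ ω, (Matrix.kroneckerMap (· * ·) (K ω) (1 : Matrix n n ℂ))ᴴ *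
      Matrix.kroneckerMap (· * ·) (K ω) (1 : Matrix n n ℂ) =
      Matrix.kroneckerMap (· * ·) ((K ω)ᴴ * K ω) (1 : Matrix n n ℂ) := by
    intro ω
    rw [Matrix.conjTranspose_kronecker, ← Matrix.mul_kronecker_mul]
    simp
  simp only [this]
  ext x y
  have hx := congrFun (congrFun h x.1) y.1
  simp only [Matrix.sum_apply] at hx
  simp only [Matrix.sum_apply, Matrix.kroneckerMap_apply, ← Finset.sum_mul, hx]
  rcases x with ⟨x₁, x₂⟩
  rcases y with ⟨y₁, y₂⟩
  simp only [Matrix.one_apply, Prod.mk.injEq]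
  by_cases h₁ : x₁ = y₁ <;> simp [h₁]

namespace Protocol

/-- A measurement on the first tensor factor, followed by protocols that depend on the outcome. -/
lemma exists_round_tensor {S R U : Sys k} (j : Fin k) {N : ℕ} {S' : Fin N → Sys k}
    (A : ∀ (ω : Fin N) (i : Fin k), Matrix ((S' ω).idx i) (S.idx i) ℂ)
    (isometry : ∀ ω i, i ≠ j → (A ω i)ᴴ * A ω i = 1)
    (complete : ∑ ω, (A ω j)ᴴ * A ω j = 1) (next : ∀ ω, Protocol U ((S' ω).tensor R)) :
    ∃ P : Protocol U (S.tensor R), ∀ (ψ : S.H) (ρ : R.H),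
      P.output (tensorVec ψ ρ) = ∑ ω, (next ω).output (tensorVec (localApply (A ω) ψ) ρ) := by
  refine ⟨.round (S.tensor R) j N (fun ω => (S' ω).tensor R)
    (fun ω i => Matrix.kroneckerMap (· * ·) (A ω i) (1 : Matrix (R.idx i) (R.idx i) ℂ))
    (fun ω i hi => kronecker_isometry (isometry ω i hi) (by simp))
    (one_kronecker_complete _ complete) next, fun ψ ρ => ?_⟩
  simp only [output]
  refine Finset.sum_congr rfl fun ω _ => ?_
  have := localApply_kronecker (A ω) (fun i => (1 : Matrix (R.idx i) (R.idx i) ℂ)) ψ ρ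
  rw [localApply_one] at this
  exact congrArg _ this

/-- A local isometry is a round with a single outcome; some party must nominally measure, hence `0 <
k`. -/
lemma exists_localIsometry {S T U : Sys k} (hk : 0 < k) (V : ∀ i, Matrix (T.idx i) (S.idx i) ℂ)
    (hV : ∀ i, (V i)ᴴ * V i = 1) (Q : Protocol U T) :
    ∃ P : Protocol U S, ∀ ψ, P.output ψ = Q.output (localApply V ψ) :=
  ⟨.round S ⟨0, hk⟩ 1 (fun _ => T) (fun _ => V) (fun _ i _ => hV i) (by simp [hV]) (fun _ => Q),
    fun ψ => by simp [output]⟩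

/-- Parties can discard the first tensor factor and go on with the second one. -/
lemma exists_discard {R U : Sys k} (hk : 0 < k) (Q : Protocol U R) (S : Sys k) :
    ∃ D : Protocol U (S.tensor R), ∀ (v : S.H) (ρ : R.H),
      D.output (tensorVec v ρ) = ((‖v‖ ^ 2 : ℝ) : ℂ) • Q.output ρ := by
  classical
  -- Induction on the number of parties whose discarded factor is not one-dimensional. Each step
  -- measures one such factor in its standard basis and leaves a one-dimensional space; a
  -- zero-dimensional factor gives a measurement without outcomes.
  induction hc : (Finset.univ.filter fun i => Fintype.card (S.idx i) ≠ 1).card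
    generalizing S with
  | zero =>
    have h1 : ∀ i, Fintype.card (S.idx i) = 1 := by
      intro i
      by_contra h
      have : i ∈ Finset.univ.filter fun i => Fintype.card (S.idx i) ≠ 1 := by simp [h]
      rw [Finset.card_eq_zero.mp hc] at this
      simp at this
    have h2 : ∀ i, Nonempty (Unique (S.idx i)) := fun i =>
      Fintype.card_eq_one_iff_nonempty_unique.mp (h1 i)
    let hu : ∀ i, Unique (S.idx i) := fun i => (h2 i).some
    have h3 : ∀ (v : S.H) (ρ : R.H) (x : ∀ i, S.idx i × R.idx i),
        (v (fun i => (hu i).default) • ρ) (fun i => Equiv.uniqueProd (R.idx i) (S.idx i) (x i)) =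
          tensorVec v ρ x := by
      intro v ρ x
      have : (fun i => (x i).1) = fun i => (hu i).default := by
        funext i; exact (hu i).uniq _
      simp [tensorVec_apply, this, Equiv.uniqueProd]
    obtain ⟨D, hD⟩ := exists_localIsometry (S := S.tensor R) hk _
      (renameMatrix_isometry (S := S.tensor R) (T := R)
        fun i => Equiv.uniqueProd (R.idx i) (S.idx i)) Q
    refine ⟨D, fun v ρ => ?_⟩
    rw [hD, localApply_renameMatrix _ (h3 v ρ), output_smul, EuclideanSpace.norm_sq_eq,
      Fintype.sum_unique]
    rfl
  | succ n ih =>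
    obtain ⟨j, hj⟩ : ∃ j, Fintype.card (S.idx j) ≠ 1 := by
      have : (Finset.univ.filter fun i => Fintype.card (S.idx i) ≠ 1).Nonempty := by
        rw [← Finset.card_pos]; omega
      obtain ⟨j, hj⟩ := this
      exact ⟨j, by simpa using hj⟩
    obtain ⟨D, hD⟩ := ih (S.replaceAt (Sys.diag k 1) j) (by
      have : (Finset.univ.filter fun i =>
          Fintype.card ((S.replaceAt (Sys.diag k 1) j).idx i) ≠ 1) =
          (Finset.univ.filter fun i => Fintype.card (S.idx i) ≠ 1).erase j := by
        ext i
        simp only [card_pick, Finset.mem_filter, Finset.mem_univ, true_and, Finset.mem_erase,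
          Fintype.card_fin, decide_eq_true_eq]
        split_ifs with h
        · simp [h]
        · simp [h]
      rw [this, Finset.card_erase_of_mem (by simpa using hj), hc]
      rfl)
    let K : Fin (Fintype.card (S.idx j)) → ∀ i, Matrix (Fin 1) (S.idx i) ℂ := fun ω i =>
      Matrix.of fun _ x => if (Fintype.equivFin (S.idx i) x : ℕ) = ω then 1 else 0
    have hiso : ∀ ω i, i ≠ j →
        (pickMatrix (K ω i) (decide (i = j)))ᴴ * pickMatrix (K ω i) (decide (i = j)) = 1 :=
      fun ω i hi => pickMatrix_isometry _ _ fun h => absurd (of_decide_eq_true h) hi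
    have hcomp : ∑ ω, (pickMatrix (K ω j) (decide (j = j)))ᴴ *
        pickMatrix (K ω j) (decide (j = j)) = 1 := by
      refine pickMatrix_complete _ _ (by simp) ?_
      ext x y
      simp only [K, Matrix.sum_apply, Matrix.mul_apply, Matrix.conjTranspose_apply, Matrix.of_apply,
        Matrix.one_apply, ← Fin.ext_iff]
      simp [eq_comm]
    obtain ⟨P, hP⟩ := exists_round_tensor (R := R) (U := U) j
      (S' := fun _ => S.replaceAt (Sys.diag k 1) j)
      (fun ω i => pickMatrix (K ω i) (decide (i = j))) hiso hcomp fun _ => D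
    refine ⟨P, fun v ρ => ?_⟩
    simp only [hP, hD]
    rw [← sum_norm_sq_localApply (S' := fun _ => S.replaceAt (Sys.diag k 1) j) j _ hiso hcomp v,
      ← Finset.sum_smul]
    push_cast
    rfl

end Protocol

/-! ### Composition of transformations and repeated blocks. -/

/-- Run `P` on the first tensor factor; upon success go on with `Qs`, otherwise discard the first
factor and go on with `Qf`. -/
lemma Protocol.exists_bind {S T R U : Sys k} (hk : 0 < k) {φ : T.H} (hφ : ‖φ‖ = 1)
    (Qs : Protocol U (T.tensor R)) (Qf : Protocol U R) (P : Protocol T S) :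
    ∃ B : Protocol U (S.tensor R), ∀ (ψ : S.H) (ρ : R.H), P.Aligned φ ψ →
      B.output (tensorVec ψ ρ) = (P.prob ψ : ℂ) • Qs.output (tensorVec φ ρ) +
        ((‖ψ‖ ^ 2 - P.prob ψ : ℝ) : ℂ) • Qf.output ρ := by
  induction P with
  | success =>
    refine ⟨Qs, ?_⟩
    rintro ψ ρ ⟨z, rfl⟩
    rw [prob_success, smul_tensorVec, output_smul, norm_smul, hφ, mul_one, sub_self]
    simp
  | failure S =>
    obtain ⟨D, hD⟩ := exists_discard hk Qf S
    refine ⟨D, fun ψ ρ _ => ?_⟩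
    rw [hD, prob_failure, sub_zero]
    simp
  | round S j N S' A isometry complete next ih =>
    choose B hB using ih
    obtain ⟨P, hP⟩ := exists_round_tensor (R := R) (U := U) j A isometry complete B
    refine ⟨P, fun ψ ρ h => ?_⟩
    -- Success weight adds over the outcomes, and so does total weight; hence failure weight does
    -- too.
    rw [hP, prob_round, ← sum_norm_sq_localApply j A isometry complete ψ,
      Finset.sum_congr rfl fun ω _ => hB ω _ ρ (h ω), Finset.sum_add_distrib, ← Finset.sum_smul,
      ← Finset.sum_smul, ← Finset.sum_sub_distrib]
    push_cast
    rfl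

lemma Transforms.bind {S T R U : Sys k} (hk : 0 < k) {ψ : S.H} {φ : T.H} {ρ : R.H} {χ : U.H}
    {p a b : ℝ} (hψ : ‖ψ‖ = 1) (hφ : ‖φ‖ = 1) (h : Transforms ψ φ p)
    (hs : Transforms (tensorVec φ ρ) χ a) (hf : Transforms ρ χ b) :
    Transforms (tensorVec ψ ρ) χ (p * a + (1 - p) * b) := by
  obtain ⟨P, hP⟩ := h
  obtain ⟨Qs, hs⟩ := hs
  obtain ⟨Qf, hf⟩ := hf
  obtain ⟨B, hB⟩ := Protocol.exists_bind hk hφ Qs Qf P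
  refine ⟨B, ?_⟩
  rw [hB ψ ρ (Protocol.aligned_of_output hφ hP), Protocol.prob_eq_of_output hφ hP, hs, hf, hψ,
    smul_smul, smul_smul, ← add_smul]
  push_cast
  simp

lemma Transforms.refl {S : Sys k} (ψ : S.H) : Transforms ψ ψ 1 :=
  ⟨.success, by simp [Protocol.output]⟩

lemma Transforms.zero {S T : Sys k} (ψ : S.H) (φ : T.H) : Transforms ψ φ 0 :=
  ⟨.failure S, by simp [Protocol.output]⟩

lemma Transforms.rename_left {S T U : Sys k} (hk : 0 < k) {ψ : S.H} {φ : T.H} {χ : U.H} {p : ℝ}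
    (h : Renaming ψ φ) (ht : Transforms φ χ p) : Transforms ψ χ p := by
  obtain ⟨V, hV, rfl⟩ := h.exists_isometry
  obtain ⟨Q, hQ⟩ := ht
  obtain ⟨P, hP⟩ := Protocol.exists_localIsometry hk V hV Q
  exact ⟨P, by rw [hP, hQ]⟩

lemma Transforms.trans {S T U : Sys k} (hk : 0 < k) {ψ : S.H} {φ : T.H} {χ : U.H} {p a : ℝ}
    (hψ : ‖ψ‖ = 1) (hφ : ‖φ‖ = 1) (h : Transforms ψ φ p) (ht : Transforms φ χ a) :
    Transforms ψ χ (p * a) := by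
  -- The spectator is a zeroth tensor power, hence trivial; a failed first stage is a failure
  -- overall.
  have := Transforms.bind (ρ := powVec ψ 0) hk hψ hφ h
    (ht.rename_left hk (rename_tensor_powVec_zero φ ψ)) (Transforms.zero _ _)
  rw [mul_zero, add_zero] at this
  exact this.rename_left hk (rename_tensor_powVec_zero ψ ψ).symm

lemma Transforms.rename_right {S T U : Sys k} (hk : 0 < k) {ψ : S.H} {φ : T.H} {χ : U.H} {p : ℝ}
    (hψ : ‖ψ‖ = 1) (hφ : ‖φ‖ = 1) (ht : Transforms ψ φ p) (h : Renaming φ χ) :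
    Transforms ψ χ p := by
  simpa using ht.trans hk hψ hφ ((Transforms.refl χ).rename_left hk h)

lemma Transforms.tensor_left {S T R : Sys k} (hk : 0 < k) {ψ : S.H} {φ : T.H} {p : ℝ}
    (hψ : ‖ψ‖ = 1) (hφ : ‖φ‖ = 1) (ρ : R.H) (hρ : ‖ρ‖ = 1) (h : Transforms ψ φ p) :
    Transforms (tensorVec ρ ψ) (tensorVec ρ φ) p := by
  have h1 := Transforms.bind (ρ := ρ) hk hψ hφ h (Transforms.refl _) (Transforms.zero _ _)
  rw [mul_zero, add_zero, mul_one] at h1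
  exact (h1.rename_left hk (rename_tensor_swap ρ ψ)).rename_right hk
    (by simp [norm_tensorVec, hψ, hρ]) (by simp [norm_tensorVec, hφ, hρ]) (rename_tensor_swap φ ρ)

/-- Binding with a protocol that always fails discards the first factor and leaves only the failure
continuation. -/
lemma Transforms.discard_left {S R U : Sys k} (hk : 0 < k) {ψ : S.H} {ρ : R.H} {χ : U.H} {p : ℝ}
    (hψ : ‖ψ‖ = 1) (h : Transforms ρ χ p) : Transforms (tensorVec ψ ρ) χ p := by
  simpa using Transforms.bind hk hψ hψ (Transforms.zero ψ ψ) (Transforms.zero _ _) h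

lemma Transforms.powVec_of_le {S : Sys k} (hk : 0 < k) {ψ : S.H} (hψ : ‖ψ‖ = 1) {a b : ℕ}
    (hab : a ≤ b) : Transforms (powVec ψ b) (powVec ψ a) 1 := by
  obtain ⟨c, rfl⟩ := Nat.exists_eq_add_of_le' hab
  exact ((Transforms.refl (powVec ψ a)).discard_left hk (by simp [norm_powVec, hψ])).rename_left hk
    (rename_powVec_add ψ c a).symm

/-- Running a protocol on `N` independent blocks yields exactly `s` successes with binomial
probability. -/
lemma Transforms.powVec_binomial {S T : Sys k} (hk : 0 < k) {ψ : S.H} {φ : T.H} (hψ : ‖ψ‖ = 1)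
    (hφ : ‖φ‖ = 1) {m n : ℕ} {p : ℝ} (h : Transforms (powVec ψ n) (powVec φ m) p) (N s : ℕ) :
    Transforms (powVec ψ (n * N)) (powVec φ (m * s))
      (N.choose s * p ^ s * (1 - p) ^ (N - s)) := by
  have hψn : ∀ n, ‖powVec ψ n‖ = 1 := fun n => by simp [norm_powVec, hψ]
  have hφn : ∀ n, ‖powVec φ n‖ = 1 := fun n => by simp [norm_powVec, hφ]
  induction N generalizing s with
  | zero =>
    cases s with
    | zero =>
      simpa using (Transforms.refl (unitVec k 1)).rename_left hk (rename_powVec_zero ψ)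
        |>.rename_right hk (hψn 0) (by rw [(rename_powVec_zero ψ).norm_eq, hψn])
          (rename_powVec_zero φ).symm
    | succ s => simpa using Transforms.zero _ _
  | succ N ih =>
    have hl : Renaming (powVec ψ (n * (N + 1))) (tensorVec (powVec ψ n) (powVec ψ (n * N))) := by
      rw [mul_add, mul_one, add_comm]
      exact (rename_powVec_add ψ n (n * N)).symm
    cases s with
    | zero =>
      -- Exactly zero successes are wanted, so a success of the first block counts as overall
      -- failure.
      have := (Transforms.bind hk (hψn n) (hφn m) h (Transforms.zero _ _) (ih 0)).rename_left hk hl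
      convert this using 1
      simp
      ring
    | succ s =>
      have hr : Renaming (tensorVec (powVec φ m) (powVec φ (m * s))) (powVec φ (m * (s + 1))) := by
        rw [mul_add, mul_one, add_comm]
        exact rename_powVec_add φ m (m * s)
      have hs := ((ih s).tensor_left hk (hψn _) (hφn _) (powVec φ m) (hφn m)).rename_right hk
        (by simp [norm_tensorVec, hψn, hφn]) (by simp [norm_tensorVec, hφn]) hr
      have := (Transforms.bind hk (hψn n) (hφn m) h hs (ih (s + 1))).rename_left hk hl
      convert this using 1
      rw [Nat.choose_succ_succ]
      -- Pascal's rule. When `N < s + 1` the exponent `N - (s + 1)` truncates, but its binomial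
      -- coefficient vanishes.
      rcases Nat.lt_or_ge N (s + 1) with hN | hN
      · rw [Nat.choose_eq_zero_of_lt hN]
        have : N + 1 - (s + 1) = N - s := by omega
        rw [this]
        push_cast
        ring
      · obtain ⟨d, rfl⟩ := Nat.exists_eq_add_of_le hN
        have h1 : s + 1 + d + 1 - (s + 1) = d + 1 := by omega
        have h2 : s + 1 + d - s = d + 1 := by omega
        have h3 : s + 1 + d - (s + 1) = d := by omega
        rw [h1, h2, h3]
        push_cast
        ring

lemma Transforms.powVec_of_block {S T : Sys k} (hk : 0 < k) {ψ : S.H} {φ : T.H} (hψ : ‖ψ‖ = 1)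
    (hφ : ‖φ‖ = 1) {m n : ℕ} {p : ℝ} (h : Transforms (powVec ψ n) (powVec φ m) p) {N L s M : ℕ}
    (hL : n * N ≤ L) (hM : M ≤ m * s) :
    Transforms (powVec ψ L) (powVec φ M) (N.choose s * p ^ s * (1 - p) ^ (N - s)) := by
  have hψn : ∀ n, ‖powVec ψ n‖ = 1 := fun n => by simp [norm_powVec, hψ]
  have hφn : ∀ n, ‖powVec φ n‖ = 1 := fun n => by simp [norm_powVec, hφ]
  simpa using ((powVec_of_le hk hψ hL).trans hk (hψn _) (hψn _)
    (powVec_binomial hk hψ hφ h N s)).trans hk (hψn _) (hφn _) (powVec_of_le hk hφ hM)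

/-! ### Binomial probabilities and binary relative entropy. -/

/-- The Poisson weight `s ^ j / j!` is largest at `j = s`: the factors separating the two factorials
are at least `s` when `j ≥ s` and at most `s` when `j ≤ s`. -/
lemma factorial_mul_pow_le (s j : ℕ) : s.factorial * s ^ j ≤ j.factorial * s ^ s := by
  rcases le_total s j with h | h
  · calc s.factorial * s ^ j = s.factorial * s ^ (j - s) * s ^ s := by
          rw [mul_assoc, ← pow_add, Nat.sub_add_cancel h]
      _ ≤ j.factorial * s ^ s := Nat.mul_le_mul_right _ (Nat.factorial_mul_pow_sub_le_factorial h)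
  · have h1 := Nat.factorial_mul_descFactorial (Nat.sub_le s j)
    rw [Nat.sub_sub_self h] at h1
    calc s.factorial * s ^ j = j.factorial * s.descFactorial (s - j) * s ^ j := by rw [h1]
      _ ≤ j.factorial * s ^ (s - j) * s ^ j := by gcongr; exact Nat.descFactorial_le_pow _ _
      _ = j.factorial * s ^ s := by rw [mul_assoc, ← pow_add, Nat.sub_add_cancel h]

/-- The binomial law with parameter `s / N`, cleared of denominators, has mode `s`; multiply the
Poisson comparisons for successes and failures. -/
lemma choose_mul_pow_le_mode {N s j : ℕ} (hs : s ≤ N) (hj : j ≤ N) :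
    N.choose j * (s ^ j * (N - s) ^ (N - j)) ≤ N.choose s * (s ^ s * (N - s) ^ (N - s)) := by
  have h1 := Nat.choose_mul_factorial_mul_factorial hs
  have h2 := Nat.choose_mul_factorial_mul_factorial hj
  have h3 := Nat.mul_le_mul (factorial_mul_pow_le s j) (factorial_mul_pow_le (N - s) (N - j))
  have hpos : 0 < s.factorial * (N - s).factorial * (j.factorial * (N - j).factorial) := by
    positivity
  refine Nat.le_of_mul_le_mul_right ?_ hpos
  calc N.choose j * (s ^ j * (N - s) ^ (N - j)) *
        (s.factorial * (N - s).factorial * (j.factorial * (N - j).factorial))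
      = (N.choose j * j.factorial * (N - j).factorial) *
          (s.factorial * s ^ j * ((N - s).factorial * (N - s) ^ (N - j))) := by ring
    _ ≤ (N.choose j * j.factorial * (N - j).factorial) *
          (j.factorial * s ^ s * ((N - j).factorial * (N - s) ^ (N - s))) :=
        Nat.mul_le_mul_left _ h3
    _ = N.choose s * (s ^ s * (N - s) ^ (N - s)) *
        (s.factorial * (N - s).factorial * (j.factorial * (N - j).factorial)) := by
      rw [h2, ← h1]; ring

/-- The binomial expansion of `(s + (N - s)) ^ N` has `N + 1` terms, none exceeding the modal one.
-/
lemma pow_self_le_choose_mul {N s : ℕ} (hs : s ≤ N) :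
    N ^ N ≤ (N + 1) * (N.choose s * (s ^ s * (N - s) ^ (N - s))) := by
  calc N ^ N = (s + (N - s)) ^ N := by rw [Nat.add_sub_cancel' hs]
    _ = ∑ j ∈ Finset.range (N + 1), s ^ j * (N - s) ^ (N - j) * N.choose j := by
      rw [add_pow]; simp
    _ ≤ ∑ j ∈ Finset.range (N + 1), N.choose s * (s ^ s * (N - s) ^ (N - s)) := by
      refine Finset.sum_le_sum fun j hj => ?_
      rw [mul_comm]
      exact choose_mul_pow_le_mode hs (Nat.lt_succ_iff.mp (Finset.mem_range.mp hj))
    _ = _ := by simp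

lemma mul_logb_div {x y : ℝ} (hy : 0 < y) :
    x * Real.logb 2 (x / y) = x * Real.logb 2 x - x * Real.logb 2 y := by
  rcases eq_or_ne x 0 with rfl | hx
  · simp
  · rw [Real.logb_div hx hy.ne']; ring

/-- Reduces continuity in `x`, including at 0 and 1, to that of `Real.binEntropy`. -/
lemma binRelEntropy_eq {p : ℝ} (hp0 : 0 < p) (hp1 : p < 1) (x : ℝ) :
    binRelEntropy x p =
      -(Real.binEntropy x / Real.log 2) - x * Real.logb 2 p - (1 - x) * Real.logb 2 (1 - p) := by
  rw [binRelEntropy, mul_logb_div hp0, mul_logb_div (sub_pos.mpr hp1), Real.binEntropy]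
  simp only [Real.logb, Real.log_inv]
  ring

lemma continuous_binRelEntropy {p : ℝ} (hp0 : 0 < p) (hp1 : p < 1) :
    Continuous fun x => binRelEntropy x p := by
  have := Real.binEntropy_continuous
  simp only [binRelEntropy_eq hp0 hp1]
  fun_prop

lemma sub_le_mul_log_div {x y : ℝ} (hx : 0 ≤ x) (hy : 0 < y) : x - y ≤ x * Real.log (x / y) := by
  rcases hx.eq_or_lt with rfl | hx
  · simp [hy.le]
  · have := mul_le_mul_of_nonneg_left (Real.one_sub_inv_le_log_of_pos (div_pos hx hy)) hx.le
    rw [inv_div, mul_sub, mul_one, mul_div_cancel₀ _ hx.ne'] at this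
    exact this

lemma binRelEntropy_nonneg {x p : ℝ} (hx : x ∈ Set.Icc (0 : ℝ) 1) (hp0 : 0 < p) (hp1 : p < 1) :
    0 ≤ binRelEntropy x p := by
  have h1 := sub_le_mul_log_div hx.1 hp0
  have h2 := sub_le_mul_log_div (sub_nonneg.mpr hx.2) (sub_pos.mpr hp1)
  have : binRelEntropy x p = (x * Real.log (x / p) + (1 - x) * Real.log ((1 - x) / (1 - p))) /
      Real.log 2 := by
    simp only [binRelEntropy, Real.logb]; ring
  rw [this]
  exact div_nonneg (by linarith) (Real.log_nonneg one_le_two)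

lemma binRelEntropy_self {p : ℝ} : binRelEntropy p p = 0 := by
  have h : ∀ x : ℝ, Real.logb 2 (x / x) = 0 := by
    intro x
    rcases eq_or_ne x 0 with rfl | hx
    · simp
    · simp [div_self hx]
  simp [binRelEntropy, h]

lemma logb_pow_self (s : ℕ) : Real.logb 2 ((s : ℝ) ^ s) = s * Real.logb 2 s := by
  rw [Real.logb_pow]

/-- The method of types lower bound for a binomial probability. -/
lemma two_rpow_binRelEntropy_le {p : ℝ} (hp0 : 0 < p) (hp1 : p < 1) {N s : ℕ} (hs : s ≤ N) :
    (2 : ℝ) ^ (-(N * binRelEntropy (s / N) p) - Real.logb 2 (N + 1)) ≤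
      N.choose s * p ^ s * (1 - p) ^ (N - s) := by
  rcases Nat.eq_zero_or_pos N with rfl | hN
  · obtain rfl : s = 0 := by omega
    simp
  obtain ⟨l, rfl⟩ := Nat.exists_eq_add_of_le hs
  have hp1' : 0 < 1 - p := sub_pos.mpr hp1
  have hN' : (0 : ℝ) < (s + l : ℕ) := by exact_mod_cast hN
  have hchoose : (0 : ℝ) < (s + l).choose s := by exact_mod_cast Nat.choose_pos hs
  have hself : ∀ a : ℕ, (0 : ℝ) < (a : ℝ) ^ a := by
    intro a
    rcases Nat.eq_zero_or_pos a with rfl | ha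
    · simp
    · positivity
  have h1 := pow_self_le_choose_mul hs
  rw [Nat.add_sub_cancel_left] at h1 ⊢
  have h2 : (((s + l : ℕ) : ℝ)) ^ (s + l) ≤
      (((s + l : ℕ) : ℝ) + 1) * ((s + l).choose s * ((s : ℝ) ^ s * (l : ℝ) ^ l)) := by
    exact_mod_cast h1
  have h3 := Real.logb_le_logb_of_le one_lt_two (hself _) h2
  rw [Real.logb_mul (by positivity) (mul_pos hchoose (mul_pos (hself s) (hself l))).ne',
    Real.logb_mul hchoose.ne' (mul_pos (hself s) (hself l)).ne',
    Real.logb_mul (hself s).ne' (hself l).ne', logb_pow_self, logb_pow_self, logb_pow_self] at h3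
  rw [← Real.le_logb_iff_rpow_le one_lt_two (by positivity),
    Real.logb_mul (by positivity) (by positivity), Real.logb_mul hchoose.ne' (by positivity),
    Real.logb_pow, Real.logb_pow, binRelEntropy]
  have e1 : (1 : ℝ) - s / (s + l : ℕ) = l / (s + l : ℕ) := by
    field_simp; push_cast; ring
  have e2 : ∀ (a : ℕ) (y : ℝ), 0 < y → ((s + l : ℕ) : ℝ) *
      ((a : ℝ) / (s + l : ℕ) * Real.logb 2 ((a : ℝ) / (s + l : ℕ) / y)) =
      a * Real.logb 2 a - a * Real.logb 2 (s + l : ℕ) - a * Real.logb 2 y := by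
    intro a y hy
    rw [← mul_assoc, mul_div_cancel₀ _ hN'.ne', div_div, mul_logb_div (by positivity),
      Real.logb_mul hN'.ne' hy.ne']
    ring
  rw [e1, mul_add, e2 s p hp0, e2 l _ hp1']
  have e3 : ((s + l : ℕ) : ℝ) * Real.logb 2 (s + l : ℕ) =
      s * Real.logb 2 (s + l : ℕ) + l * Real.logb 2 (s + l : ℕ) := by
    push_cast; ring
  linarith

/-! ### Asymptotics of the block construction: achievability. -/

open Filter Asymptotics

lemma tendsto_natDiv_atTop {n : ℕ} (hn : 1 ≤ n) :
    Tendsto (fun L : ℕ => ((L / n : ℕ) : ℝ)) atTop atTop :=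
  tendsto_natCast_atTop_atTop.comp (Nat.tendsto_div_const_atTop (by omega))

lemma isLittleO_natCast_of_bounded {f : ℕ → ℝ} (C : ℝ) (hf : ∀ L, |f L| ≤ C) :
    f =o[atTop] (fun L : ℕ => (L : ℝ)) := by
  have h1 : f =O[atTop] (fun _ : ℕ => (1 : ℝ)) :=
    IsBigO.of_bound C (Eventually.of_forall fun L => by simpa using hf L)
  refine h1.trans_isLittleO ?_
  rw [isLittleO_const_left]
  right
  exact tendsto_norm_atTop_atTop.comp tendsto_natCast_atTop_atTop

lemma natDiv_bounds {n : ℕ} (hn : 1 ≤ n) (L : ℕ) :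
    0 ≤ (L : ℝ) / n - (L / n : ℕ) ∧ (L : ℝ) / n - (L / n : ℕ) ≤ 1 := by
  have h1 := Nat.cast_div_le (m := L) (n := n) (α := ℝ)
  have h2 := Nat.lt_div_mul_add (a := L) (b := n) (by omega)
  have h3 : (L : ℝ) < (L / n : ℕ) * n + n := by exact_mod_cast h2
  have hn' : (0 : ℝ) < n := by exact_mod_cast hn
  refine ⟨by linarith, ?_⟩
  rw [sub_le_iff_le_add, div_le_iff₀ hn']
  linarith

lemma binomial_exponent {n : ℕ} (hn : 1 ≤ n) {p x : ℝ} (hp0 : 0 < p) (hp1 : p < 1)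
    (hx : x ∈ Set.Icc (0 : ℝ) 1) :
    ∃ e : ℕ → ℝ, e =o[atTop] (fun L : ℕ => (L : ℝ)) ∧ ∀ L : ℕ,
      (2 : ℝ) ^ (-(1 / (n : ℝ) * binRelEntropy x p) * L + e L) ≤
        (L / n).choose ⌊x * (L / n : ℕ)⌋₊ * p ^ ⌊x * (L / n : ℕ)⌋₊ *
          (1 - p) ^ (L / n - ⌊x * (L / n : ℕ)⌋₊) := by
  set D := binRelEntropy x p
  set N : ℕ → ℕ := fun L => L / n
  set y : ℕ → ℝ := fun L => (⌊x * (N L : ℕ)⌋₊ : ℝ) / (N L : ℕ)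
  -- Three sublinear errors: incomplete blocks (bounded), replacing `x` by the actual success
  -- fraction `y L` (continuity), and the polynomial factor `N + 1` from the method of types.
  refine ⟨fun L => ((L : ℝ) / n - N L) * D + N L * (D - binRelEntropy (y L) p) -
    Real.logb 2 (N L + 1), ?_, fun L => ?_⟩
  · have hNO : (fun L => (N L : ℝ)) =O[atTop] (fun L : ℕ => (L : ℝ)) :=
      IsBigO.of_bound 1 (Eventually.of_forall fun L => by
        simp only [N, Real.norm_natCast, one_mul]
        exact_mod_cast Nat.div_le_self L n)
    refine IsLittleO.sub (IsLittleO.add ?_ ?_) ?_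
    · refine isLittleO_natCast_of_bounded |D| fun L => ?_
      have := natDiv_bounds hn L
      rw [abs_mul]
      exact mul_le_of_le_one_left (abs_nonneg _) (abs_le.mpr ⟨by linarith [this.1], this.2⟩)
    · have h1 : Tendsto y atTop (nhds x) :=
        (tendsto_nat_floor_mul_div_atTop hx.1).comp (tendsto_natDiv_atTop hn)
      have h2 : Tendsto (fun L => D - binRelEntropy (y L) p) atTop (nhds 0) := by
        have := (((continuous_binRelEntropy hp0 hp1).tendsto x).comp h1).const_sub D
        simpa [D] using this
      have := hNO.mul_isLittleO ((isLittleO_one_iff ℝ).mpr h2)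
      simpa using this
    · have h1 : Tendsto (fun L => (N L : ℝ) + 1) atTop atTop :=
        tendsto_atTop_add_const_right _ _ (tendsto_natDiv_atTop hn)
      have h2 := Real.isLittleO_log_id_atTop.comp_tendsto h1
      have h3 : (fun L => (N L : ℝ) + 1) =O[atTop] (fun L : ℕ => (L : ℝ)) :=
        hNO.add (isLittleO_natCast_of_bounded 1 (by simp)).isBigO
      have h4 := (h2.trans_isBigO h3).const_mul_left (Real.log 2)⁻¹
      refine h4.congr_left fun L => ?_
      simp [Real.logb, div_eq_inv_mul]
  · have hs : ⌊x * (N L : ℕ)⌋₊ ≤ N L :=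
      Nat.floor_le_of_le (mul_le_of_le_one_left (Nat.cast_nonneg _) hx.2)
    refine le_of_eq_of_le ?_ (two_rpow_binRelEntropy_le hp0 hp1 hs)
    congr 1
    simp only [y]
    ring

lemma achievable_of_block {S T : Sys k} (hk : 0 < k) {ψ : S.H} {φ : T.H} (hψ : ‖ψ‖ = 1)
    (hφ : ‖φ‖ = 1) {m n : ℕ} (hn : 1 ≤ n) {p : ℝ} (hp : p ∈ Set.Icc (0 : ℝ) 1)
    (h : Transforms (powVec ψ n) (powVec φ m) p) {q : ℝ} (hq : q ∈ Set.Icc (0 : ℝ) 1)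
    (hpq : 0 < p ∨ q = 0) :
    Achievable ψ φ (q * ((m : ℝ) / n)) (1 / (n : ℝ) * binRelEntropy (max p q) p) := by
  have hx : max p q ∈ Set.Icc (0 : ℝ) 1 := ⟨le_max_of_le_left hp.1, max_le hp.2 hq.2⟩
  have key : 0 ≤ binRelEntropy (max p q) p ∧
      ∃ e : ℕ → ℝ, e =o[atTop] (fun L : ℕ => (L : ℝ)) ∧ ∀ L : ℕ,
      (2 : ℝ) ^ (-(1 / (n : ℝ) * binRelEntropy (max p q) p) * L + e L) ≤
        (L / n).choose ⌊max p q * (L / n : ℕ)⌋₊ * p ^ ⌊max p q * (L / n : ℕ)⌋₊ *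
          (1 - p) ^ (L / n - ⌊max p q * (L / n : ℕ)⌋₊) := by
    rcases hp.1.eq_or_lt with h0 | h0
    -- The deterministic cases `p = 0` and `p = 1` ask for 0 and `N` successes respectively, which
    -- occur with probability one.
    · have hq0 : q = 0 := hpq.resolve_left h0.not_lt
      subst hq0 h0
      rw [max_self, binRelEntropy_self]
      exact ⟨le_rfl, 0, isLittleO_zero _ _, by simp⟩
    rcases hp.2.eq_or_lt with h1 | h1
    · subst h1
      rw [max_eq_left hq.2, binRelEntropy_self]
      exact ⟨le_rfl, 0, isLittleO_zero _ _, by simp⟩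
    · exact ⟨binRelEntropy_nonneg hx h0 h1, binomial_exponent hn h0 h1 hx⟩
  obtain ⟨hr, e, he, hprob⟩ := key
  -- The protocol obtains `⌊max p q * N⌋` successes but keeps only `⌊q * N⌋` of them, so for `q ≤ p`
  -- the exponent is zero.
  refine ⟨mul_nonneg hq.1 (by positivity), mul_nonneg (by positivity) hr,
    fun L => m * ⌊q * (L / n : ℕ)⌋₊, e, ?_, he, fun L => ⟨_, hprob L, ?_⟩⟩
  · refine isLittleO_natCast_of_bounded (m + m) fun L => ?_
    have h1 := natDiv_bounds hn L
    have hqN : 0 ≤ q * ((L / n : ℕ) : ℝ) := mul_nonneg hq.1 (Nat.cast_nonneg _)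
    have h2 := Nat.floor_le hqN
    have h3 := (Nat.lt_floor_add_one (q * ((L / n : ℕ) : ℝ))).le
    have hm : (0 : ℝ) ≤ m := Nat.cast_nonneg m
    have e1 : ((m * ⌊q * ((L / n : ℕ) : ℝ)⌋₊ : ℕ) : ℝ) - q * ((m : ℝ) / n) * L =
        m * (⌊q * ((L / n : ℕ) : ℝ)⌋₊ - q * (L / n : ℕ)) -
          m * (q * ((L : ℝ) / n - (L / n : ℕ))) := by
      push_cast; ring
    have h4 : 0 ≤ q * ((L : ℝ) / n - (L / n : ℕ)) := mul_nonneg hq.1 h1.1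
    have h5 : q * ((L : ℝ) / n - (L / n : ℕ)) ≤ 1 := mul_le_one₀ hq.2 h1.1 h1.2
    rw [e1]
    refine (abs_sub _ _).trans (add_le_add ?_ ?_)
    · rw [abs_mul, abs_of_nonneg hm]
      exact mul_le_of_le_one_right hm (abs_le.mpr ⟨by linarith, by linarith⟩)
    · rw [abs_mul, abs_of_nonneg hm]
      exact mul_le_of_le_one_right hm (abs_le.mpr ⟨by linarith, by linarith⟩)
  · refine h.powVec_of_block hk hψ hφ (Nat.mul_div_le L n) (Nat.mul_le_mul_left m ?_)
    exact Nat.floor_le_floor (mul_le_mul_of_nonneg_right (le_max_right _ _) (Nat.cast_nonneg _))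

/-! ### Label projections and dilation of local measurements. -/

lemma siteApply_siteApply {S : Sys k} (j : Fin k) (P Q : Matrix (S.idx j) (S.idx j) ℂ) (ψ : S.H) :
    siteApply j P (siteApply j Q ψ) = siteApply j (P * Q) ψ := by
  rw [siteApply, siteApply, localApply_localApply, siteApply]
  congr 1
  funext i
  by_cases hi : i = j
  · subst hi; simp
  · simp [Function.update_of_ne hi]

lemma siteApply_one {S : Sys k} (j : Fin k) (ψ : S.H) : siteApply j 1 ψ = ψ := by
  rw [siteApply, Function.update_eq_self_iff.mpr rfl, localApply_one]

lemma localApply_smul_one {S : Sys k} (c : Fin k → ℂ) (ψ : S.H) :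
    localApply (fun i => c i • (1 : Matrix (S.idx i) (S.idx i) ℂ)) ψ = (∏ i, c i) • ψ := by
  ext y
  simp only [localApply_apply, Matrix.smul_apply, smul_eq_mul, Finset.prod_mul_distrib,
    Matrix.one_apply, Fintype.prod_boole, ← funext_iff, PiLp.smul_apply]
  simp

/-- The projection onto the span of the basis elements with label in `s`. -/
def labelProj {X Ω : Type} [DecidableEq X] [DecidableEq Ω] (f : X → Ω) (s : Finset Ω) :
    Matrix X X ℂ :=
  Matrix.diagonal fun x => if f x ∈ s then 1 else 0

section labelProj

variable {X Ω : Type} [DecidableEq X] [DecidableEq Ω] (f : X → Ω)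

lemma labelProj_isHermitian (s : Finset Ω) : (labelProj f s).IsHermitian := by
  refine Matrix.isHermitian_diagonal_of_self_adjoint _ ?_
  ext x
  simp only [Pi.star_apply]
  split_ifs <;> simp

lemma labelProj_mul [Fintype X] (s t : Finset Ω) :
    labelProj f s * labelProj f t = labelProj f (s ∩ t) := by
  rw [labelProj, labelProj, Matrix.diagonal_mul_diagonal, labelProj]
  congr 1
  ext x
  by_cases h1 : f x ∈ s <;> by_cases h2 : f x ∈ t <;> simp [h1, h2]

lemma one_sub_labelProj_mul [Fintype X] {s t : Finset Ω} :
    (1 - labelProj f s) * labelProj f t = labelProj f (t \ s) := by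
  rw [sub_mul, one_mul, labelProj_mul, labelProj, labelProj, labelProj, Matrix.diagonal_sub]
  congr 1
  ext x
  by_cases h1 : f x ∈ s <;> by_cases h2 : f x ∈ t <;> simp [h1, h2]

lemma labelProj_univ [Fintype Ω] : labelProj f Finset.univ = 1 := by
  simp [labelProj]

end labelProj

/-- The label of a basis element of a possibly replaced space. -/
def pickLabel {X Y Ω : Type} (g : X → Ω) : ∀ b : Bool, Pick b X Y → Option Ω
  | true, x => some (g x)
  | false, _ => none

/-- The identity if the flag is set, `B` otherwise. -/
def pickOut {X Y : Type} [DecidableEq X] (B : Matrix X Y ℂ) :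
    ∀ b : Bool, Matrix X (Pick b X Y) ℂ
  | true => (1 : Matrix X X ℂ)
  | false => B

section pick

variable {X Y Ω : Type} [Fintype X] [DecidableEq X] [DecidableEq Y] [DecidableEq Ω]

lemma pickOut_isometry (B : Matrix X Y ℂ) (b : Bool) (h : b = false → Bᴴ * B = 1) :
    (pickOut B b)ᴴ * pickOut B b = 1 := by
  cases b with
  | true => exact (by simp : (1 : Matrix X X ℂ)ᴴ * 1 = 1)
  | false => exact h rfl

lemma pickOut_mul_labelProj_mul [Fintype Y] (g : X → Ω) (ω : Ω) (B K : Matrix X Y ℂ) (b : Bool)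
    (hb : b = true) :
    pickOut B b * (labelProj (pickLabel (Y := Y) g b) {some ω} * pickMatrix K b) =
      Matrix.of fun x y => if g x = ω then K x y else 0 := by
  subst hb
  change (1 : Matrix X X ℂ) * (labelProj (fun x => some (g x)) {some ω} * K) = _
  ext x y
  simp [labelProj, Matrix.diagonal_mul]

lemma pickOut_mul_pickMatrix [Fintype Y] (B K : Matrix X Y ℂ) (b : Bool) (hb : b = false) :
    pickOut B b * ((1 : Matrix (Pick b X Y) (Pick b X Y) ℂ) * pickMatrix K b) = B := by
  subst hb
  change B * (1 * (1 : Matrix Y Y ℂ)) = B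
  simp

end pick

/-- The inclusion of the block `ω` into a direct sum of spaces. -/
def blockIncl {N : ℕ} {X : Fin N → Type} [∀ ω, DecidableEq (X ω)] (ω : Fin N) :
    Matrix (Σ ω, X ω) (X ω) ℂ :=
  Matrix.of fun y x => if y = ⟨ω, x⟩ then 1 else 0

lemma blockIncl_isometry {N : ℕ} {X : Fin N → Type} [∀ ω, Fintype (X ω)] [∀ ω, DecidableEq (X ω)]
    (ω : Fin N) : (blockIncl (X := X) ω)ᴴ * blockIncl (X := X) ω = 1 := by
  ext x x'
  simp [blockIncl, Matrix.mul_apply, Matrix.one_apply, eq_comm]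

lemma blockIncl_mul {N : ℕ} {X : Fin N → Type} [∀ ω, Fintype (X ω)] [∀ ω, DecidableEq (X ω)]
    {Y : Type} (A : ∀ ω, Matrix (X ω) Y ℂ) (ω : Fin N) :
    blockIncl (X := X) ω * A ω = Matrix.of fun y x => if y.1 = ω then A y.1 y.2 x else 0 := by
  ext ⟨ω', y⟩ x
  simp only [blockIncl, Matrix.mul_apply, Matrix.of_apply]
  by_cases h : ω' = ω
  · subst h
    simp
  · simp [h]

/-- A local measurement is a local isometry followed by a projective measurement of the label of a
block at the measuring party, up to local isometries depending on the outcome. -/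
lemma exists_dilation {S : Sys k} {N : ℕ} {S' : Fin N → Sys k} (j : Fin k)
    (A : ∀ (ω : Fin N) (i : Fin k), Matrix ((S' ω).idx i) (S.idx i) ℂ)
    (isometry : ∀ ω i, i ≠ j → (A ω i)ᴴ * A ω i = 1)
    (complete : ∑ ω, (A ω j)ᴴ * A ω j = 1) :
    ∃ (R T : Sys k) (V : ∀ i, Matrix (R.idx i) (S.idx i) ℂ) (f : R.idx j → Option (Fin N))
      (Z : Fin N → ∀ i, Matrix (T.idx i) (R.idx i) ℂ)
      (W : ∀ (ω : Fin N) (i : Fin k), Matrix (T.idx i) ((S' ω).idx i) ℂ),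
      (∀ i, (V i)ᴴ * V i = 1) ∧ (∀ ω i, (Z ω i)ᴴ * Z ω i = 1) ∧ (∀ ω i, (W ω i)ᴴ * W ω i = 1) ∧
      ∀ ω ψ, localApply (Z ω) (siteApply j (labelProj f {some ω}) (localApply V ψ)) =
        localApply (W ω) (localApply (A ω) ψ) := by
  let T : Sys k := { idx := fun i => Σ ω, (S' ω).idx i }
  let K : ∀ i, Matrix (T.idx i) (S.idx i) ℂ := fun i => Matrix.of fun y x => A y.1 i y.2 x
  let W : ∀ (ω : Fin N) (i : Fin k), Matrix (T.idx i) ((S' ω).idx i) ℂ := fun ω i =>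
    blockIncl (X := fun ω => (S' ω).idx i) ω
  have hW : ∀ ω i, (W ω i)ᴴ * W ω i = 1 := fun ω i => blockIncl_isometry ω
  have hWA : ∀ ω i, W ω i * A ω i = Matrix.of fun y x => if y.1 = ω then K i y x else 0 :=
    fun ω i => blockIncl_mul (fun ω => A ω i) ω
  -- `V` acts only at party `j`, stacking its Kraus operators into one isometry. The other parties
  -- act afterwards through `Z`, and all outcomes are compared in the common direct sum `T`. The
  -- label `none` serves only the unused flag value and never occurs at party `j`.
  refine ⟨S.replaceAt T j, T, fun i => pickMatrix (K i) (decide (i = j)),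
    pickLabel (fun x => x.1) (decide (j = j)),
    fun ω i => pickOut (W ω i * A ω i) (decide (i = j)), W, ?_, ?_, hW, ?_⟩
  · intro i
    refine pickMatrix_isometry _ _ fun h => ?_
    obtain rfl := of_decide_eq_true h
    rw [← complete]
    ext x x'
    simp only [K, T, Matrix.mul_apply, Matrix.conjTranspose_apply, Matrix.of_apply,
      Matrix.sum_apply, Fintype.sum_sigma]
  · intro ω i
    refine pickOut_isometry _ _ fun h => ?_
    rw [Matrix.conjTranspose_mul, Matrix.mul_assoc, ← Matrix.mul_assoc (W ω i)ᴴ, hW, Matrix.one_mul,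
      isometry ω i (of_decide_eq_false h)]
  · intro ω ψ
    rw [siteApply, localApply_localApply, localApply_localApply, localApply_localApply]
    congr 1
    funext i
    by_cases hi : i = j
    · subst hi
      rw [Function.update_self, hWA, Matrix.mul_assoc]
      exact pickOut_mul_labelProj_mul (fun x : T.idx i => x.1) ω (W ω i * A ω i) (K i)
        (decide (i = i)) (decide_eq_true rfl)
    · rw [Function.update_of_ne hi, Matrix.mul_assoc]
      exact pickOut_mul_pickMatrix (W ω i * A ω i) (K i) (decide (i = j)) (decide_eq_false hi)

/-! ### Monotonicity of spectral points under LOCC. -/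

namespace IsSpectralPoint

variable {α : ℝ} {F : Functional k}

/-- Iterates the two-outcome projection axiom, splitting off one label at a time. -/
lemma sum_labelProj_le (hF : IsSpectralPoint α F) (hα : α ≠ 0) {S : Sys k} (j : Fin k)
    {Ω : Type} [DecidableEq Ω] (f : S.idx j → Ω) (s : Finset Ω) (ψ : S.H) :
    ∑ ω ∈ s, F S (siteApply j (labelProj f {ω}) ψ) ^ (1 / α) ≤
      F S (siteApply j (labelProj f s) ψ) ^ (1 / α) := by
  induction s using Finset.induction_on with
  | empty => simpa using Real.rpow_nonneg (hF.nonneg _ _) _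
  | insert ω s hω ih =>
    have h := hF.projection S (siteApply j (labelProj f (insert ω s)) ψ) j (labelProj f {ω})
      (labelProj_isHermitian f _) (by rw [labelProj_mul, Finset.inter_self])
    have h1 : ({ω} : Finset Ω) ∩ insert ω s = {ω} :=
      Finset.inter_eq_left.mpr (by simp)
    have h2 : insert ω s \ {ω} = s := by
      rw [Finset.sdiff_singleton_eq_erase, Finset.erase_insert hω]
    rw [if_neg hα, siteApply_siteApply, siteApply_siteApply, labelProj_mul, one_sub_labelProj_mul,
      h1, h2] at h
    rw [Finset.sum_insert hω]
    linarith

lemma sum_measurement_le (hF : IsSpectralPoint α F) (hα : α ≠ 0) {S : Sys k} {N : ℕ}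
    {S' : Fin N → Sys k} (j : Fin k)
    (A : ∀ (ω : Fin N) (i : Fin k), Matrix ((S' ω).idx i) (S.idx i) ℂ)
    (isometry : ∀ ω i, i ≠ j → (A ω i)ᴴ * A ω i = 1)
    (complete : ∑ ω, (A ω j)ᴴ * A ω j = 1) (ψ : S.H) :
    ∑ ω, F (S' ω) (localApply (A ω) ψ) ^ (1 / α) ≤ F S ψ ^ (1 / α) := by
  obtain ⟨R, T, V, f, Z, W, hV, hZ, hW, h⟩ := exists_dilation j A isometry complete
  have h1 := hF.sum_labelProj_le hα j f Finset.univ (localApply V ψ)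
  rw [labelProj_univ, siteApply_one, hF.isometry_invariant _ _ V ψ hV, Fintype.sum_option] at h1
  have h2 : ∀ ω, F (S' ω) (localApply (A ω) ψ) =
      F R (siteApply j (labelProj f {some ω}) (localApply V ψ)) := by
    intro ω
    rw [← hF.isometry_invariant _ _ (W ω) _ (hW ω), ← h,
      hF.isometry_invariant _ _ (Z ω) _ (hZ ω)]
  simp only [h2]
  linarith [Real.rpow_nonneg (hF.nonneg R (siteApply j (labelProj f {none}) (localApply V ψ)))
    (1 / α)]

lemma measurement_le_of_zero (hF : IsSpectralPoint 0 F) {S : Sys k} {N : ℕ}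
    {S' : Fin N → Sys k} (j : Fin k)
    (A : ∀ (ω : Fin N) (i : Fin k), Matrix ((S' ω).idx i) (S.idx i) ℂ)
    (isometry : ∀ ω i, i ≠ j → (A ω i)ᴴ * A ω i = 1)
    (complete : ∑ ω, (A ω j)ᴴ * A ω j = 1) (ψ : S.H) (ω : Fin N) :
    F (S' ω) (localApply (A ω) ψ) ≤ F S ψ := by
  obtain ⟨R, T, V, f, Z, W, hV, hZ, hW, h⟩ := exists_dilation j A isometry complete
  have h1 := hF.projection R (localApply V ψ) j (labelProj f {some ω}) (labelProj_isHermitian f _)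
    (by rw [labelProj_mul, Finset.inter_self])
  rw [if_pos rfl, hF.isometry_invariant _ _ V ψ hV] at h1
  rw [← hF.isometry_invariant _ _ (W ω) _ (hW ω), ← h, hF.isometry_invariant _ _ (Z ω) _ (hZ ω)]
  exact (le_max_left _ _).trans h1

/-- The phase is a unitary at one party; the modulus is covered by the scaling axiom. -/
lemma map_smul (hF : IsSpectralPoint α F) (hk : 0 < k) {S : Sys k} {z : ℂ} (hz : z ≠ 0)
    (ψ : S.H) : F S (z • ψ) = (‖z‖ ^ 2) ^ α * F S ψ := by
  have hz' : (‖z‖ : ℂ) ≠ 0 := by simpa using hz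
  set u : ℂ := z / ‖z‖ with hu
  have hnu : star u * u = 1 := by
    rw [RCLike.star_def, mul_comm, Complex.mul_conj, Complex.normSq_eq_norm_sq, hu]
    simp [hz]
  let c : Fin k → ℂ := fun i => if i = ⟨0, hk⟩ then u else 1
  have h1 : localApply (fun i => c i • (1 : Matrix (S.idx i) (S.idx i) ℂ)) ψ = u • ψ := by
    rw [localApply_smul_one]
    simp [c]
  have h2 : F S (u • ψ) = F S ψ := by
    rw [← h1]
    refine hF.isometry_invariant _ _ _ _ fun i => ?_
    simp only [c]
    split_ifs
    · rw [Matrix.conjTranspose_smul, Matrix.conjTranspose_one, smul_mul_smul_comm, hnu]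
      simp
    · simp
  have h3 : z • ψ = ((Real.sqrt (‖z‖ ^ 2) : ℝ) : ℂ) • u • ψ := by
    rw [Real.sqrt_sq (norm_nonneg z), smul_smul, hu, mul_div_cancel₀ _ hz']
  rw [h3, hF.scaling _ _ _ (by positivity), h2]

lemma rpow_map_smul (hF : IsSpectralPoint α F) (hk : 0 < k) (hα : 0 < α) {S : Sys k} (z : ℂ)
    (ψ : S.H) : ‖z‖ ^ 2 * F S ψ ^ (1 / α) ≤ F S (z • ψ) ^ (1 / α) := by
  rcases eq_or_ne z 0 with rfl | hz
  · simpa using Real.rpow_nonneg (hF.nonneg _ _) _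
  · rw [hF.map_smul hk hz, Real.mul_rpow (by positivity) (hF.nonneg _ _), ← Real.rpow_mul
      (by positivity), mul_one_div_cancel hα.ne', Real.rpow_one]

/-- Here `d` is the value credited per unit of failure probability. The case `d = 0` needs only
nonnegativity and yields `norm_sq_le`, which in turn justifies `d = 1`. -/
lemma le_of_aligned (hF : IsSpectralPoint α F) (hk : 0 < k) (hα : 0 < α) {d : ℝ}
    (hd : ∀ (S : Sys k) (v : S.H), d * ‖v‖ ^ 2 ≤ F S v ^ (1 / α)) {S T : Sys k} {φ : T.H}
    (hφ : ‖φ‖ = 1) (P : Protocol T S) (ψ : S.H) (h : P.Aligned φ ψ) :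
    P.prob ψ * F T φ ^ (1 / α) + d * (‖ψ‖ ^ 2 - P.prob ψ) ≤ F S ψ ^ (1 / α) := by
  induction P with
  | success =>
    obtain ⟨z, rfl⟩ := h
    rw [Protocol.prob_success, sub_self, mul_zero, add_zero, norm_smul, hφ, mul_one]
    exact hF.rpow_map_smul hk hα z φ
  | failure S => simpa [Protocol.prob_failure] using hd S ψ
  | round S j N S' A isometry complete next ih =>
    refine le_trans ?_ (hF.sum_measurement_le hα.ne' j A isometry complete ψ)
    rw [Protocol.prob_round, ← sum_norm_sq_localApply j A isometry complete ψ,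
      ← Finset.sum_sub_distrib, Finset.mul_sum, Finset.sum_mul, ← Finset.sum_add_distrib]
    exact Finset.sum_le_sum fun ω _ => ih ω _ (h ω)

lemma le_of_aligned_zero (hF : IsSpectralPoint 0 F) (hk : 0 < k) {S T : Sys k} {φ : T.H}
    (P : Protocol T S) (ψ : S.H) (h : P.Aligned φ ψ) (hp : 0 < P.prob ψ) : F T φ ≤ F S ψ := by
  induction P with
  | success =>
    obtain ⟨z, rfl⟩ := h
    have hz : z ≠ 0 := by
      rintro rfl
      simp [Protocol.prob_success] at hp
    rw [hF.map_smul hk hz, Real.rpow_zero, one_mul]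
  | failure S => simp [Protocol.prob_failure] at hp
  | round S j N S' A isometry complete next ih =>
    rw [Protocol.prob_round] at hp
    obtain ⟨ω, -, hω⟩ := Finset.exists_lt_of_sum_lt (s := Finset.univ)
      (f := fun _ : Fin N => (0 : ℝ))
      (by simpa using hp)
    exact (ih ω _ (h ω) hω).trans (hF.measurement_le_of_zero j A isometry complete ψ ω)

lemma norm_unitVec_one : ‖unitVec k 1‖ = 1 := by
  rw [(rename_powVec_zero (unitVec k 1)).norm_eq, norm_powVec, pow_zero]

lemma exists_transform_unit (hk : 0 < k) (S : Sys k) :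
    ∃ P : Protocol (Sys.diag k 1) (S.tensor (Sys.diag k 1)), ∀ v : S.H,
      P.output (tensorVec v (unitVec k 1)) = ((‖v‖ ^ 2 : ℝ) : ℂ) • ketbra (unitVec k 1) := by
  obtain ⟨D, hD⟩ := Protocol.exists_discard hk (.success : Protocol (Sys.diag k 1) _) S
  exact ⟨D, fun v => by rw [hD, Protocol.output]⟩

/-- Discarding turns `v` into the rank-one unit tensor, of value 1, with total weight `‖v‖ ^ 2`. -/
lemma norm_sq_le (hF : IsSpectralPoint α F) (hk : 0 < k) (hα : 0 < α) {S : Sys k} (v : S.H) :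
    ‖v‖ ^ 2 ≤ F S v ^ (1 / α) := by
  obtain ⟨P, hP⟩ := exists_transform_unit hk S
  have := hF.le_of_aligned hk hα (d := 0)
    (fun S v => by simpa using Real.rpow_nonneg (hF.nonneg _ _) _) norm_unitVec_one P _
    (Protocol.aligned_of_output norm_unitVec_one (hP v))
  rw [Protocol.prob_eq_of_output norm_unitVec_one (hP v), hF.multiplicative, hF.unit] at this
  simpa using this

lemma one_le_of_zero (hF : IsSpectralPoint 0 F) (hk : 0 < k) {S : Sys k} {v : S.H} (hv : v ≠ 0) :
    1 ≤ F S v := by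
  obtain ⟨P, hP⟩ := exists_transform_unit hk S
  have := hF.le_of_aligned_zero hk P _ (Protocol.aligned_of_output norm_unitVec_one (hP v))
    (by rw [Protocol.prob_eq_of_output norm_unitVec_one (hP v)]; positivity)
  rw [hF.multiplicative, hF.unit] at this
  simpa using this

lemma map_rename (hF : IsSpectralPoint α F) {S T : Sys k} {ψ : S.H} {φ : T.H} (h : Renaming ψ φ) :
    F T φ = F S ψ := by
  obtain ⟨V, hV, rfl⟩ := h.exists_isometry
  exact hF.isometry_invariant _ _ V ψ hV

lemma map_powVec (hF : IsSpectralPoint α F) {S : Sys k} (ψ : S.H) (n : ℕ) :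
    F (S.pow n) (powVec ψ n) = F S ψ ^ n := by
  induction n with
  | zero => rw [← hF.map_rename (rename_powVec_zero ψ), hF.unit]; simp
  | succ n ih =>
    rw [hF.map_rename (rename_powVec_add ψ n 1), hF.multiplicative, ih, pow_succ,
      hF.map_rename (rename_powVec_one ψ).symm]

/-- The functional bounds the success probability of exact transformations. -/
lemma le_of_transforms (hF : IsSpectralPoint α F) (hk : 0 < k) (hα : 0 < α) {S T : Sys k}
    {ψ : S.H} {φ : T.H} (hψ : ‖ψ‖ = 1) (hφ : ‖φ‖ = 1) {p : ℝ} (h : Transforms ψ φ p) :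
    p * F T φ ^ (1 / α) + (1 - p) ≤ F S ψ ^ (1 / α) := by
  obtain ⟨P, hP⟩ := h
  have := hF.le_of_aligned hk hα (d := 1) (fun S v => by simpa using hF.norm_sq_le hk hα v) hφ P ψ
    (Protocol.aligned_of_output hφ hP)
  rw [Protocol.prob_eq_of_output hφ hP, hψ] at this
  simpa using this

end IsSpectralPoint

/-! ### Bounds for logarithmic spectral points. -/

variable {S T : Sys k} {ψ : S.H} {φ : T.H} {m n : ℕ} {p : ℝ}

lemma IsLogSpectralPoint.le_of_transforms {α : ℝ} {E : Functional k} (hk : 0 < k)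
    (hψ : ‖ψ‖ = 1) (hφ : ‖φ‖ = 1) (hn : 1 ≤ n) (hp : p ∈ Set.Icc (0 : ℝ) 1)
    (h : Transforms (powVec ψ n) (powVec φ m) p) (hα : α ∈ Set.Ioo (0 : ℝ) 1)
    (hE : IsLogSpectralPoint α E) :
    1 / (n : ℝ) * (α / (1 - α)) *
      Real.logb 2 (p * (2 : ℝ) ^ ((m : ℝ) * ((1 - α) / α) * E T φ) + (1 - p)) ≤ E S ψ := by
  obtain ⟨-, F, hF, hEF⟩ := hE
  have hα0 := hα.1
  have hα1 : 0 < 1 - α := sub_pos.mpr hα.2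
  have hn' : (0 : ℝ) < n := by exact_mod_cast hn
  have hpos : ∀ {S : Sys k} {v : S.H}, ‖v‖ = 1 → 0 < F S v := by
    intro S v hv
    refine (hF.nonneg S v).lt_of_ne' fun h0 => ?_
    have := hF.norm_sq_le hk hα0 v
    rw [hv, h0, Real.zero_rpow (one_div_pos.mpr hα0).ne'] at this
    norm_num at this
  have hne : ∀ {S : Sys k} {v : S.H}, ‖v‖ = 1 → v ≠ 0 := by
    rintro S v hv rfl
    simp at hv
  have key := hF.le_of_transforms hk hα0 (by simp [norm_powVec, hψ]) (by simp [norm_powVec, hφ]) h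
  rw [hF.map_powVec, hF.map_powVec] at key
  have e1 : (2 : ℝ) ^ ((m : ℝ) * ((1 - α) / α) * E T φ) = (F T φ ^ m) ^ (1 / α) := by
    rw [hEF _ _ (hne hφ), ← Real.rpow_natCast, ← Real.rpow_mul (hpos hφ).le]
    conv_rhs => rw [← Real.rpow_logb two_pos (by norm_num) (hpos hφ)]
    rw [← Real.rpow_mul two_pos.le]
    congr 1
    field_simp
  rw [e1, hEF _ _ (hne hψ)]
  have hφm : 0 < (F T φ ^ m) ^ (1 / α) := Real.rpow_pos_of_pos (pow_pos (hpos hφ) m) _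
  have hX : 0 < p * (F T φ ^ m) ^ (1 / α) + (1 - p) := by
    rcases hp.1.eq_or_lt with h0 | h0
    · rw [← h0]; norm_num
    · have := mul_pos h0 hφm
      linarith [hp.2]
  have hlog := Real.logb_le_logb_of_le one_lt_two hX key
  rw [Real.logb_rpow_eq_mul_logb_of_pos (pow_pos (hpos hψ) n), Real.logb_pow] at hlog
  calc 1 / (n : ℝ) * (α / (1 - α)) * Real.logb 2 (p * (F T φ ^ m) ^ (1 / α) + (1 - p))
      ≤ 1 / (n : ℝ) * (α / (1 - α)) * (1 / α * (n * Real.logb 2 (F S ψ))) := by gcongr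
    _ = Real.logb 2 (F S ψ) / (1 - α) := by field_simp

lemma IsLogSpectralPoint.zero_le_of_transforms {E : Functional k} (hk : 0 < k)
    (hψ : ‖ψ‖ = 1) (hφ : ‖φ‖ = 1) (hn : 1 ≤ n) (hp : 0 < p)
    (h : Transforms (powVec ψ n) (powVec φ m) p) (hE : IsLogSpectralPoint 0 E) :
    (m : ℝ) / n * E T φ ≤ E S ψ := by
  obtain ⟨-, F, hF, hEF⟩ := hE
  have hn' : (0 : ℝ) < n := by exact_mod_cast hn
  have hne : ∀ {S : Sys k} {v : S.H}, ‖v‖ = 1 → v ≠ 0 := by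
    rintro S v hv rfl
    simp at hv
  obtain ⟨P, hP⟩ := h
  have hφm : ‖powVec φ m‖ = 1 := by simp [norm_powVec, hφ]
  have key := hF.le_of_aligned_zero hk P _ (Protocol.aligned_of_output hφm hP)
    (by rwa [Protocol.prob_eq_of_output hφm hP])
  rw [hF.map_powVec, hF.map_powVec] at key
  have hlog := Real.logb_le_logb_of_le one_lt_two
    (pow_pos (zero_lt_one.trans_le (hF.one_le_of_zero hk (hne hφ))) m) key
  rw [Real.logb_pow, Real.logb_pow] at hlog
  rw [hEF _ _ (hne hφ), hEF _ _ (hne hψ), sub_zero, div_one, div_one, div_mul_eq_mul_div,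
    div_le_iff₀ hn']
  linarith

/-- Weighted AM-GM for `2 ^ x` and 1, that is, concavity of the logarithm. -/
lemma mul_le_logb_mul_two_rpow_add {p : ℝ} (hp : p ∈ Set.Icc (0 : ℝ) 1) (x : ℝ) :
    p * x ≤ Real.logb 2 (p * (2 : ℝ) ^ x + (1 - p)) := by
  have h := Real.geom_mean_le_arith_mean2_weighted hp.1 (sub_nonneg.mpr hp.2)
    (Real.rpow_nonneg two_pos.le x) zero_le_one (by ring)
  rw [Real.one_rpow, mul_one, mul_one, ← Real.rpow_mul two_pos.le, mul_comm x p] at h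
  rwa [Real.le_logb_iff_rpow_le one_lt_two ((Real.rpow_pos_of_pos two_pos _).trans_le h)]

lemma IsLogSpectralPointOne.le_of_transforms {E : Functional k} (hk : 0 < k)
    (hψ : ‖ψ‖ = 1) (hφ : ‖φ‖ = 1) (hn : 1 ≤ n) (hp : p ∈ Set.Icc (0 : ℝ) 1)
    (h : Transforms (powVec ψ n) (powVec φ m) p) (hE : IsLogSpectralPointOne E) :
    p * ((m : ℝ) / n) * E T φ ≤ E S ψ := by
  obtain ⟨l, hl, hev, -, hlim⟩ := hE
  refine le_of_tendsto_of_tendsto ((hlim T φ hφ).const_mul (p * ((m : ℝ) / n))) (hlim S ψ hψ) ?_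
  filter_upwards [hev] with x hx
  refine le_trans ?_ (hx.2.le_of_transforms hk hψ hφ hn hp h hx.1)
  have hα0 := hx.1.1
  have hα1 : 0 < 1 - x.1 := sub_pos.mpr hx.1.2
  have hn' : (0 : ℝ) < n := by exact_mod_cast hn
  have := mul_le_logb_mul_two_rpow_add hp ((m : ℝ) * ((1 - x.1) / x.1) * x.2 T φ)
  -- The factors `α / (1 - α)` and `(1 - α) / α` cancel, so the linearised bound has a coefficient
  -- independent of the order and survives the limit.
  calc p * ((m : ℝ) / n) * x.2 T φ
      = 1 / (n : ℝ) * (x.1 / (1 - x.1)) * (p * ((m : ℝ) * ((1 - x.1) / x.1) * x.2 T φ)) := by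
        field_simp
    _ ≤ _ := by gcongr

end

end LOCCSpectrum

open LOCCSpectrum

theorem mainTheorem10 {k : ℕ} (hk : 2 ≤ k) {S T : Sys k} (ψ : S.H) (φ : T.H)
    (hψ : ‖ψ‖ = 1) (hφ : ‖φ‖ = 1) (m n : ℕ) (hn : 1 ≤ n)
    (p : ℝ) (hp : p ∈ Set.Icc (0 : ℝ) 1)
    (hLOCC : Transforms (powVec ψ n) (powVec φ m) p) :
    -- achievable pairs, whenever the exponent is finite
    (∀ q ∈ Set.Icc (0 : ℝ) 1, (0 < p ∨ q = 0) →
      Achievable ψ φ (q * ((m : ℝ) / n)) (1 / (n : ℝ) * binRelEntropy (max p q) p)) ∧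
    -- spectral points of order in (0, 1)
    (∀ α ∈ Set.Ioo (0 : ℝ) 1, ∀ E : Functional k, IsLogSpectralPoint α E →
      1 / (n : ℝ) * (α / (1 - α)) *
          Real.logb 2 (p * (2 : ℝ) ^ ((m : ℝ) * ((1 - α) / α) * E T φ) + (1 - p)) ≤ E S ψ) ∧
    -- order 0
    (0 < p → ∀ E : Functional k, IsLogSpectralPoint 0 E → (m : ℝ) / n * E T φ ≤ E S ψ) ∧
    -- order 1
    (∀ E : Functional k, IsLogSpectralPointOne E → p * ((m : ℝ) / n) * E T φ ≤ E S ψ) := by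
  have hk' : 0 < k := by omega
  exact ⟨fun q hq hpq => achievable_of_block hk' hψ hφ hn hp hLOCC hq hpq,
    fun α hα E hE => hE.le_of_transforms hk' hψ hφ hn hp hLOCC hα,
    fun hp0 E hE => hE.zero_le_of_transforms hk' hψ hφ hn hp0 hLOCC,
    fun E hE => hE.le_of_transforms hk' hψ hφ hn hp hLOCC⟩
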